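/- **Setting.** A function $f:[0,1)\to\mathbb R$ is càdlàg ($f\in\mathcal D$) if it is right-continuous on $[0,1)$ and has a finite left limit at every point of $(0,1]$. For each $n\ge 1$ one observes $y_i^n=n\int_{[i/n,(i+1)/n)}f(x)\,dx+\xi_i^n$, $0\le i\le n-1$, where $f\in\mathcal D$ and $\xi_0^n,\dots,\xi_{n-1}^n$ are independent and centered with $\mathbb E e^{u\xi_i^n}\le e^{u^2\sigma^2/2}$ for all $u\in\mathbb R$. Let $\mathcal S$ be the set of right-continuous step functions $g$ on $[0,1)$ with finite set $J(g)\subset(0,1)$ of jumps, $\mathcal A^\gamma_{2,L}$ the set of $f\in\mathcal D$ with $\|f\|_{L^\infty}\le L$ and $k^\gamma\inf\{\|f-g\|_{L^2}: g\in\mathcal S,\ \#J(g)\le k\}\le L$ for all $k\ge1$, and $m_I(f)=|I|^{-1}\int_I f$. Let $\mathcal I=\mathcal I_n$ be a $c$-normal system ($c>1$) of intervals $[a,b)\subseteq[0,1)$: every interval $I\subseteq[0,1)$ with $|I|>c/n$ contains some $\tilde I\in\mathcal I$ with $|\tilde I|\ge|I|/c$; the end-points of the intervals in $\mathcal I$ lie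 in $\{i/n:0\le i\le n\}$; and every $[i/n,(i+1)/n)$, $0\le i\le n-1$, is in $\mathcal I$. Let $s_I=s_I(z,g)$ be scale penalties, which may be random and may depend on the data vector $z$ and the candidate $g$, with $\sup_{z,g}\sup_{I\in\mathcal I}|s_I(z,g)|\le\delta\sqrt{\log n}$ almost surely for all $n\ge2$, where $\delta>0$ is a constant. Put $$T_{\mathcal I}(z;g)=\sup_{I\in\mathcal I,\ g\equiv c_I\text{ on }I}\Bigl\{\frac1{\sqrt{n|I|}}\Bigl|\sum_{i/n\in I}(z_i-c_I)\Bigr|-s_I(z,g)\Bigr\},$$ and let $\hat f_n$ be, almost surely, any minimizer of $\#J(g)$ over $g\in\mathcal S$ subject to $T_{\mathcal I}(y^n;g)\le\eta_n$. For $0<\beta<1$ let $\eta(\beta)$ be the $(1-\beta)$-quantile of $T_{\mathcal I}(\xi^n;0)$, that is, the least $x$ with $\mathbb P(T_{\mathcal I}(\xi^n;0)\le x)\ge1-\beta$. The threshold is *universal* if $\eta_n=a\sqrt{\log n}$ with $a>\delta+\sigma\sqrt{2r+4}$ for some $r>0$; it is *refined* if $\eta_n=\eta(\beta_n)$ with $\beta_n\in(0,1)$,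 $\beta_n=O(n^{-r})$ and $n^{-R}=O(\beta_n)$ for some $r,R>0$. Say that the penalties are *null-dominated* at $n$ if, almost surely, $s_I(\xi^n,0)\le s_I(y^n,g)$ for all $g\in\mathcal S$ and $I\in\mathcal I$; this holds with equality if they depend neither on the data nor on the candidate. The number of modes of a function $h$ on $[0,1)$ is the supremum of the $m$ for which there are points $x_0<u_1<x_1<\dots<u_m<x_m$ in $[0,1)$ with $h(u_i)>\max\{h(x_{i-1}),h(x_i)\}$ for all $i$ (for a step function: the number of interior segments whose value exceeds both neighbouring values); the number of troughs of $h$ is the number of modes of $-h$. For $\varepsilon>0$ let $J_\varepsilon(f)=\{x\in(0,1):|f(x)-f(x-0)|>\varepsilon\}$ and $\Delta_f^\varepsilon=\min\{|f(x)-f(x-0)|:x\in J_\varepsilon(f)\}$. **Theorem.** (i) Let $f\in\mathcal A^\gamma_{2,L}$ with $\gamma,L>0$. * *Modes and troughs.* Suppose that the threshold is universal; or that it is refined, the penalties are null-dominated at every $n$, and $\mathbb P\bigl(T_{\mathcal I}(\xi^n;0)>\eta_n-n^{-\rho}\bigr)\to0$ for some $\rho<\gamma$. Then for all integers $0\le M\le\#\mathrm{modes}(f)$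 and $0\le M'\le\#\mathrm{troughs}(f)$, with probability tending to $1$, $\hat f_n$ has at least $M$ modes and at least $M'$ troughs. In particular, if $f$ has finitely many modes and troughs, then $\lim_{n\to\infty}\mathbb P\{\#\mathrm{modes}(\hat f_n)\ge\#\mathrm{modes}(f);\ \#\mathrm{troughs}(\hat f_n)\ge\#\mathrm{troughs}(f)\}=1$. * *Jumps.* Suppose that the threshold is universal or refined. Then for every $\varepsilon>0$ $$\lim_{n\to\infty}\mathbb P\Bigl\{\max_{\tau\in J_\varepsilon(f)}\min_{\hat\tau\in J(\hat f_n)}|\tau-\hat\tau|\le\frac{C}{(\Delta_f^\varepsilon)^2}\Bigl(\frac{\log n}{n}\Bigr)^{\frac{2\gamma}{2\gamma+1}};\ \#J(\hat f_n)\ge\#J_\varepsilon(f)\Bigr\}=1,$$ where $C$ is a constant depending only on the thresholds $\eta_n$, on $c$ and on $L$. (ii) Let $n\ge1$, $0<\beta<1$, $\eta_n=\eta(\beta)$, and let the penalties be null-dominated at $n$. Put $r_I=2(\eta(\beta)+s_I)/\sqrt{n|I|}$ with $s_I=s_I(y^n,\hat f_n)$. Then, with probability at least $1-\beta$, simultaneously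 for all $I_1,I_2\in\mathcal I$ on each of which $\hat f_n$ is constant, $$m_{I_1}(\hat f_n)>m_{I_2}(\hat f_n)+r_{I_1}+r_{I_2}\quad\text{implies}\quad m_{I_1}(f)>m_{I_2}(f).$$ -/

import Mathlib

open MeasureTheory ProbabilityTheory Filter Topology Asymptotics
open scoped NNReal ENNReal

noncomputable section

namespace Multiscale

/-- Càdlàg functions on `[0,1)`: right-continuous at every point of `[0,1)`, with a finite left limit
at every point of `(0,1]`. Only the values of `f` on `[0,1)` matter. -/
def IsCadlag (f : ℝ → ℝ) : Prop :=
  (∀ x ∈ Set.Ico (0 : ℝ) 1, ContinuousWithinAt f (Set.Ici x) x) ∧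
  (∀ x ∈ Set.Ioc (0 : ℝ) 1, ∃ l : ℝ, Tendsto f (𝓝[<] x) (𝓝 l))

/-- Right-continuous step functions on `[0,1)`, `∑ c i 1_{[τ i, τ (i+1))}` with
`0 = τ 0 < ⋯ < τ (k+1) = 1` and `c i ≠ c (i+1)`. This representation of the function is unique. -/
structure StepFunction where
  k : ℕ
  τ : Fin (k + 2) → ℝ
  c : Fin (k + 1) → ℝ
  τ_zero : τ 0 = 0
  τ_last : τ (Fin.last (k + 1)) = 1
  τ_strictMono : StrictMono τ
  c_ne : ∀ i : Fin k, c i.castSucc ≠ c i.succ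

/-- The function represented by a step function (with value `0` outside `[0,1)`). -/
def StepFunction.toFun (g : StepFunction) (x : ℝ) : ℝ :=
  ∑ i : Fin (g.k + 1), (Set.Ico (g.τ i.castSucc) (g.τ i.succ)).indicator (fun _ => g.c i) x

/-- The set of change-points `{τ 1, …, τ k}`. -/
def StepFunction.jumps (g : StepFunction) : Finset ℝ :=
  Finset.univ.image fun i : Fin g.k => g.τ i.succ.castSucc

/-- The zero function as a step function. -/
def StepFunction.zero : StepFunction where
  k := 0
  τ := fun i => (i : ℕ)
  c := fun _ => 0
  τ_zero := by simp
  τ_last := by simp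
  τ_strictMono := fun i j h => Nat.cast_lt.2 h
  c_ne := fun i => i.elim0

/-- The approximation error: the infimum of `‖f - g‖_{L^q[0,1)}` over step functions `g` with at most
`k` jumps. -/
def approxError (q : ℝ≥0∞) (k : ℕ) (f : ℝ → ℝ) : ℝ≥0∞ :=
  ⨅ g : StepFunction, ⨅ _ : g.jumps.card ≤ k,
    eLpNorm (fun x => f x - g.toFun x) q (volume.restrict (Set.Ico (0 : ℝ) 1))

/-- The approximation class `A^γ_{q,L}`. -/
def ApproxClass (q : ℝ≥0∞) (γ L : ℝ) : Set (ℝ → ℝ) :=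
  {f | IsCadlag f ∧
    (∀ k : ℕ, 1 ≤ k → ENNReal.ofReal ((k : ℝ) ^ γ) * approxError q k f ≤ ENNReal.ofReal L) ∧
    eLpNorm f ⊤ (volume.restrict (Set.Ico (0 : ℝ) 1)) ≤ ENNReal.ofReal L}

/-- A pair `I` of reals stands for the interval `[I.1, I.2)`. A system of intervals is `c`-normal at
sample size `n`. -/
structure IsNormalSystem (c : ℝ) (n : ℕ) (𝓘 : Set (ℝ × ℝ)) : Prop where
  rich : ∀ a b : ℝ, 0 ≤ a → a < b → b ≤ 1 → c / n < b - a →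
    ∃ I ∈ 𝓘, Set.Ico I.1 I.2 ⊆ Set.Ico a b ∧ c⁻¹ * (b - a) ≤ I.2 - I.1
  grid : ∀ I ∈ 𝓘, ∃ i j : ℕ, i < j ∧ j ≤ n ∧ I = ((i : ℝ) / n, (j : ℝ) / n)
  cells : ∀ i : ℕ, i < n → ((i : ℝ) / n, ((i : ℝ) + 1) / n) ∈ 𝓘

open Classical in
/-- The multiscale statistic `T_𝓘(y; g)` with scale penalties `s`: the supremum over all intervals
`I ∈ 𝓘` on which `g` is equal to a constant `c` (it is `⊥` if there is no such interval). -/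
def multiscaleStat (n : ℕ) (𝓘 : Set (ℝ × ℝ)) (s : ℝ × ℝ → ℝ) (y : Fin n → ℝ) (g : ℝ → ℝ) : EReal :=
  ⨆ I ∈ 𝓘, ⨆ c : ℝ, ⨆ _ : ∀ x ∈ Set.Ico I.1 I.2, g x = c,
    ((1 / √((n : ℝ) * (I.2 - I.1)) *
        |∑ i ∈ Finset.univ.filter (fun i : Fin n => ((i : ℕ) : ℝ) / n ∈ Set.Ico I.1 I.2), (y i - c)| - s I : ℝ) : EReal)

/-- `g` minimizes the number of jumps among all step functions `h` with `T_𝓘(y; h) ≤ η`. The penalties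
`s h I` may depend on the candidate `h`. -/
def IsSegmentation (n : ℕ) (𝓘 : Set (ℝ × ℝ)) (s : StepFunction → ℝ × ℝ → ℝ) (y : Fin n → ℝ) (η : ℝ)
    (g : StepFunction) : Prop :=
  multiscaleStat n 𝓘 (s g) y g.toFun ≤ (η : EReal) ∧
  ∀ h : StepFunction, multiscaleStat n 𝓘 (s h) y h.toFun ≤ (η : EReal) →
    g.jumps.card ≤ h.jumps.card

/-- The observations `y_i = n ∫_{[i/n,(i+1)/n)} f + ξ_i`, `i = 0, …, n-1`. -/
def obs (n : ℕ) (f : ℝ → ℝ) (ξ : Fin n → ℝ) (i : Fin n) : ℝ :=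
  n * (∫ x in Set.Ico (((i : ℕ) : ℝ) / n) ((((i : ℕ) : ℝ) + 1) / n), f x) + ξ i

/-- Independent centered sub-Gaussian noise with scale parameter `σ`, that is
`E exp (u ξ_i) ≤ exp (u² σ² / 2)` for every real `u`. -/
structure IsNoise {Ω : Type*} [MeasurableSpace Ω] (μ : Measure Ω) (σ : ℝ≥0) (n : ℕ)
    (ξ : Fin n → Ω → ℝ) : Prop where
  indep : iIndepFun ξ μ
  centered : ∀ i, ∫ ω, ξ i ω ∂μ = 0
  subgaussian : ∀ i, HasSubgaussianMGF (ξ i) (σ ^ 2) μ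

/-- `q` is the `(1 - β)`-quantile of the law of `T`: the least `x` with `P (T > x) ≤ β`, equivalently
with `P (T ≤ x) ≥ 1 - β`. -/
def IsQuantile {Ω : Type*} [MeasurableSpace Ω] (μ : Measure Ω) (T : Ω → EReal) (β q : ℝ) : Prop :=
  IsLeast {x : ℝ | μ {ω | (x : EReal) < T ω} ≤ ENNReal.ofReal β} q

/-- The local mean of `f` over the interval `[I.1, I.2)`. -/
def localMean (f : ℝ → ℝ) (I : ℝ × ℝ) : ℝ :=
  (∫ x in Set.Ico I.1 I.2, f x) / (I.2 - I.1)

/-- The locations of the jumps of `f` of size larger than `ε`. -/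
def jumpSet (ε : ℝ) (f : ℝ → ℝ) : Set ℝ :=
  {x | x ∈ Set.Ioo (0 : ℝ) 1 ∧ ε < |f x - Function.leftLim f x|}

/-- The smallest size of a jump of `f` larger than `ε`. -/
def minJump (ε : ℝ) (f : ℝ → ℝ) : ℝ :=
  sInf ((fun x => |f x - Function.leftLim f x|) '' jumpSet ε f)

/-- `f` increases and then decreases at least `m` times in succession: there are points
`x 0 < y 0 < x 1 < y 1 < ⋯ < y (m-1) < x m` of `[0,1)` such that each `f (y i)` is larger than the
values of `f` at the two neighbouring points `x i` and `x (i+1)`. -/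
def HasModes (f : ℝ → ℝ) (m : ℕ) : Prop :=
  ∃ (x : Fin (m + 1) → ℝ) (y : Fin m → ℝ), (∀ i, x i ∈ Set.Ico (0 : ℝ) 1) ∧
    ∀ i : Fin m, x i.castSucc < y i ∧ y i < x i.succ ∧
      f (x i.castSucc) < f (y i) ∧ f (x i.succ) < f (y i)

/-- The number of modes of `f` (possibly infinite). For a step function it is the number of segments
with a neighbour on either side whose value exceeds the values on both neighbouring segments. -/
def numModes (f : ℝ → ℝ) : ℕ∞ := ⨆ (m : ℕ) (_ : HasModes f m), (m : ℕ∞)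

/-- The number of troughs of `f`, which are the modes of `-f`. -/
def numTroughs (f : ℝ → ℝ) : ℕ∞ := numModes fun x => - f x

/-- The penalties `s₀` of the null statistic `T_𝓘(ξ; 0)` do not exceed the penalties `s g` that any
candidate `g` is charged; for penalties that depend neither on the candidate nor on the data, both are
the same. -/
def NullDominated (𝓘 : Set (ℝ × ℝ)) (s₀ : ℝ × ℝ → ℝ) (s : StepFunction → ℝ × ℝ → ℝ) : Prop :=
  ∀ g, ∀ I ∈ 𝓘, s₀ I ≤ s g I

/-- The universal threshold `η_n = a √(log n)` with `a > δ + σ √(2 r + 4)` for some `r > 0`. -/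
def IsUniversalThreshold (σ : ℝ≥0) (δ : ℝ) (η : ℕ → ℝ) : Prop :=
  ∃ a r : ℝ, 0 < r ∧ δ + σ * √(2 * r + 4) < a ∧ ∀ n : ℕ, η n = a * √(Real.log n)

/-- The refined threshold `η_n = η(β_n)`, where `T n` is the null statistic at sample size `n` and the
levels `β_n` decrease polynomially: `β_n = O(n^{-r})` and `n^{-R} = O(β_n)` for some `r, R > 0`. -/
def IsRefinedThreshold {Ω : ℕ → Type*} [∀ n, MeasurableSpace (Ω n)] (μ : ∀ n, Measure (Ω n))
    (T : ∀ n, Ω n → EReal) (η : ℕ → ℝ) : Prop :=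
  ∃ (β : ℕ → ℝ) (r R : ℝ), 0 < r ∧ 0 < R ∧ (∀ n, β n ∈ Set.Ioo (0 : ℝ) 1) ∧
    (β =O[atTop] fun n => (n : ℝ) ^ (-r)) ∧ ((fun n : ℕ => (n : ℝ) ^ (-R)) =O[atTop] β) ∧
    ∀ n, 1 ≤ n → IsQuantile (μ n) (T n) (β n) (η n)

end Multiscale

end

open Multiscale

namespace Multiscale

/-! Everything rests on one local comparison. The observations are cell averages, so over a grid
interval `I` the sum of `y_i - v` is exactly `n|I|(m_I(f) - v)` plus the noise sum. If the estimator
equals `v` on `I` and passes the multiscale test, then `|m_I(f) - v|` is at most threshold plus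
penalty plus normalized noise, divided by `√(n|I|)` (`abs_localMean_sub_le_of_stat_le`). In (ii) the
null statistic controls the noise outside an event of measure at most `β`. In (i) a union bound over
the `O(n²)` grid intervals makes the error `O(√(log n / (n|I|)))`, which is `IsClose`.

Jumps: if the estimator had no jump within `w` of a large jump `t` of `f`, it would be constant
around `t`, and comparison on intervals to the left and to the right would put its value near both
`f (t-)` and `f t`. This is impossible once `n w / log n` is large, which holds for `w` of order
`(log n / n)^θ` with any `θ < 1` and any constant in front.

Modes: here the estimator must not have too many jumps. A near-optimal approximant of `f` with about
`n^θ` jumps, cut at `O(n^θ)` further points so that its squared error between cuts is tiny, passes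
the test as soon as the noise leaves a margin `n^(-ρ)` with `ρ < γ`. Minimality then bounds the
jumps of the estimator by `O(n^θ)` with `θ < 1` (`withHighProb_card_jumps_le`). By pigeonhole a
short fixed interval to the right of any `x` contains a jump-free piece of length of order `n^(-θ)`,
enough to force the estimator close to `f x` there. Hence it nearly attains, in the right order, the
finitely many values of `f` that witness the modes and troughs. -/

/-! ### Step functions: segments, change-points, constancy -/

theorem StepFunction.exists_mem_Ico (g : StepFunction) {x : ℝ} (hx : x ∈ Set.Ico (0 : ℝ) 1) :
    ∃ i : Fin (g.k + 1), x ∈ Set.Ico (g.τ i.castSucc) (g.τ i.succ) := by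
  by_contra! h
  have key : ∀ i : Fin (g.k + 2), g.τ i ≤ x := by
    intro i
    induction i using Fin.induction with
    | zero => rw [g.τ_zero]; exact hx.1
    | succ i ih =>
      by_contra hlt
      exact h i ⟨ih, not_le.1 hlt⟩
  have := key (Fin.last _)
  rw [g.τ_last] at this
  exact absurd hx.2 (not_lt.2 this)

theorem StepFunction.toFun_eq (g : StepFunction) {i : Fin (g.k + 1)} {x : ℝ}
    (hx : x ∈ Set.Ico (g.τ i.castSucc) (g.τ i.succ)) : g.toFun x = g.c i := by
  unfold StepFunction.toFun
  rw [Finset.sum_eq_single i]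
  · simp [Set.indicator_of_mem hx]
  · intro j _ hji
    refine Set.indicator_of_notMem (fun hj => ?_) _
    rcases lt_or_gt_of_ne hji with h | h
    · have : g.τ j.succ ≤ g.τ i.castSucc :=
        g.τ_strictMono.monotone (Fin.succ_le_castSucc_iff.2 h)
      exact absurd hj.2 (not_lt.2 (this.trans hx.1))
    · have : g.τ i.succ ≤ g.τ j.castSucc :=
        g.τ_strictMono.monotone (Fin.succ_le_castSucc_iff.2 h)
      exact absurd hx.2 (not_lt.2 (this.trans hj.1))
  · simp

theorem StepFunction.mem_jumps (g : StepFunction) {t : ℝ} :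
    t ∈ g.jumps ↔ ∃ i : Fin g.k, g.τ i.succ.castSucc = t := by
  simp [StepFunction.jumps]

theorem StepFunction.exists_Ico_subset (g : StepFunction) {a b : ℝ} (ha : 0 ≤ a) (hab : a < b)
    (hb : b ≤ 1) (h : ∀ t ∈ g.jumps, t ∉ Set.Ioo a b) :
    ∃ i : Fin (g.k + 1), Set.Ico a b ⊆ Set.Ico (g.τ i.castSucc) (g.τ i.succ) := by
  obtain ⟨i, hi⟩ := g.exists_mem_Ico ⟨ha, hab.trans_le hb⟩
  refine ⟨i, Set.Ico_subset_Ico hi.1 ?_⟩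
  rcases Fin.eq_castSucc_or_eq_last i with ⟨j, rfl⟩ | rfl
  · by_contra! hlt
    refine h _ (g.mem_jumps.2 ⟨j, rfl⟩) ⟨?_, ?_⟩
    · simpa using hi.2
    · simpa using hlt
  · rw [Fin.succ_last, g.τ_last]
    exact hb

theorem StepFunction.toFun_eq_of_no_jump (g : StepFunction) {a b : ℝ} (ha : 0 ≤ a) (hab : a < b)
    (hb : b ≤ 1) (h : ∀ t ∈ g.jumps, t ∉ Set.Ioo a b) :
    ∀ x ∈ Set.Ico a b, g.toFun x = g.toFun a := by
  obtain ⟨i, hi⟩ := g.exists_Ico_subset ha hab hb h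
  intro x hx
  rw [g.toFun_eq (hi hx), g.toFun_eq (hi ⟨le_rfl, hab⟩)]

/-- Adjacent segment values differ, so an interval of constancy cannot straddle a change-point. -/
theorem StepFunction.notMem_Ioo_of_const (g : StepFunction) {a b c : ℝ}
    (h : ∀ x ∈ Set.Ico a b, g.toFun x = c) : ∀ t ∈ g.jumps, t ∉ Set.Ioo a b := by
  intro t ht htab
  obtain ⟨i, rfl⟩ := g.mem_jumps.1 ht
  have h1 : g.toFun (g.τ i.succ.castSucc) = g.c i.succ :=
    g.toFun_eq ⟨le_rfl, g.τ_strictMono Fin.castSucc_lt_succ⟩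
  -- A point of `[a, b)` in the segment that ends at the change-point.
  set x := max a (g.τ i.castSucc.castSucc) with hx
  have hlt : g.τ i.castSucc.castSucc < g.τ i.succ.castSucc := by
    rw [← Fin.succ_castSucc]
    exact g.τ_strictMono Fin.castSucc_lt_succ
  have hxt : x < g.τ i.succ.castSucc := max_lt htab.1 hlt
  have h2 : g.toFun x = g.c i.castSucc :=
    g.toFun_eq ⟨le_max_right _ _, by rw [Fin.succ_castSucc]; exact hxt⟩
  apply g.c_ne i
  rw [← h1, ← h2, h _ ⟨htab.1.le, htab.2⟩, h x ⟨le_max_left _ _, hxt.trans htab.2⟩]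

theorem StepFunction.measurable_toFun (g : StepFunction) : Measurable g.toFun := by
  unfold StepFunction.toFun
  exact Finset.measurable_sum _ fun i _ => measurable_const.indicator measurableSet_Ico

theorem StepFunction.exists_abs_le (g : StepFunction) : ∃ B : ℝ, ∀ x, |g.toFun x| ≤ B := by
  refine ⟨∑ i, |g.c i|, fun x => ?_⟩
  refine (Finset.abs_sum_le_sum_abs _ _).trans (Finset.sum_le_sum fun i _ => ?_)
  by_cases hx : x ∈ Set.Ico (g.τ i.castSucc) (g.τ i.succ)
  · simp [Set.indicator_of_mem hx]
  · simp [Set.indicator_of_notMem hx]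

theorem exists_pos_lt_forall_ne {ν : ℝ} (hν : 0 < ν) (S : Finset ℝ) :
    ∃ θ, 0 < θ ∧ θ < ν ∧ θ ∉ S := by
  obtain ⟨θ, h1, h2⟩ := ((Set.Ioo_infinite hν).sdiff S.finite_toSet).nonempty
  exact ⟨θ, h1.1, h1.2, h2⟩

/-- A step function with prescribed jumps `P` whose value on each segment is within `ν` of the value
of `v` at the left end-point of the segment. -/
theorem exists_stepFunction (P : Finset ℝ) (hP : ∀ p ∈ P, p ∈ Set.Ioo (0 : ℝ) 1) (v : ℝ → ℝ)
    {ν : ℝ} (hν : 0 < ν) :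
    ∃ g : StepFunction, P ⊆ g.jumps ∧ g.jumps.card ≤ P.card ∧
      ∀ a b, 0 ≤ a → a < b → b ≤ 1 → (∀ t ∈ g.jumps, t ∉ Set.Ioo a b) →
        ∃ p, 0 ≤ p ∧ p ≤ a ∧ (∀ t ∈ P, t ∉ Set.Ioo p b) ∧
          ∀ x ∈ Set.Ico a b, |g.toFun x - v p| ≤ ν := by
  classical
  set Q : Finset ℝ := insert 0 (insert 1 P) with hQ
  have h1P : (1 : ℝ) ∉ P := fun h => lt_irrefl _ (hP 1 h).2
  have h0P : (0 : ℝ) ∉ insert 1 P := by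
    simp only [Finset.mem_insert, not_or]
    exact ⟨by norm_num, fun h => lt_irrefl _ (hP 0 h).1⟩
  have hcard : Q.card = P.card + 2 := by
    rw [hQ, Finset.card_insert_of_notMem h0P, Finset.card_insert_of_notMem h1P]
  have hQmem : ∀ q ∈ Q, 0 ≤ q ∧ q ≤ 1 := by
    intro q hq
    simp only [hQ, Finset.mem_insert] at hq
    rcases hq with rfl | rfl | hq
    · norm_num
    · norm_num
    · exact ⟨(hP q hq).1.le, (hP q hq).2.le⟩
  set e := Q.orderEmbOfFin hcard with he
  have hsurj : ∀ q ∈ Q, ∃ i, e i = q := by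
    intro q hq
    have : q ∈ Set.range e := by rw [he, Finset.range_orderEmbOfFin]; exact hq
    exact this
  have hemem : ∀ i, e i ∈ Q := fun i => Finset.orderEmbOfFin_mem Q hcard i
  have he0 : e 0 = 0 := by
    obtain ⟨i, hi⟩ := hsurj 0 (by simp [hQ])
    refine le_antisymm ?_ (hQmem _ (hemem 0)).1
    rw [← hi]
    exact e.monotone (Fin.zero_le i)
  have he1 : e (Fin.last _) = 1 := by
    obtain ⟨i, hi⟩ := hsurj 1 (by simp [hQ])
    refine le_antisymm (hQmem _ (hemem _)).2 ?_
    rw [← hi]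
    exact e.monotone (Fin.le_last i)
  -- A `StepFunction` must change value at every inner `τ`, whereas `v` may not. Adding `0` and `θ`
  -- alternately enforces this once `θ` avoids the absolute increments of `v`; `θ < ν` keeps the
  -- perturbation small.
  obtain ⟨θ, hθ0, hθν, hθ⟩ := exists_pos_lt_forall_ne hν
    (Finset.univ.image fun i : Fin P.card =>
      |v (e i.succ.castSucc) - v (e i.castSucc.castSucc)|)
  have hθ' : ∀ i : Fin P.card, |v (e i.succ.castSucc) - v (e i.castSucc.castSucc)| ≠ θ := by
    intro i hi
    exact hθ (Finset.mem_image.2 ⟨i, Finset.mem_univ _, hi⟩)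
  let g : StepFunction :=
    { k := P.card
      τ := e
      c := fun i => v (e i.castSucc) + if Even (i : ℕ) then 0 else θ
      τ_zero := he0
      τ_last := he1
      τ_strictMono := e.strictMono
      c_ne := by
        intro i hi
        have hne := hθ' i
        rcases Nat.even_or_odd (i : ℕ) with hev | hodd
        · have h2 : ¬ Even ((i : ℕ) + 1) := by
            rw [Nat.not_even_iff_odd]; exact hev.add_one
          simp only [Fin.val_castSucc, Fin.val_succ, hev, h2, if_true, if_false] at hi
          apply hne
          rw [show v (e i.succ.castSucc) - v (e i.castSucc.castSucc) = -θ by linarith, abs_neg,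
            abs_of_pos hθ0]
        · have h2 : Even ((i : ℕ) + 1) := hodd.add_one
          have h3 : ¬ Even (i : ℕ) := Nat.not_even_iff_odd.2 hodd
          simp only [Fin.val_castSucc, Fin.val_succ, h3, h2, if_true, if_false] at hi
          apply hne
          rw [show v (e i.succ.castSucc) - v (e i.castSucc.castSucc) = θ by linarith,
            abs_of_pos hθ0] }
  have hPg : P ⊆ g.jumps := by
    intro p hp
    obtain ⟨i, hi⟩ := hsurj p (by simp [hQ, hp])
    rw [g.mem_jumps]
    have hi0 : i ≠ 0 := by
      rintro rfl
      rw [he0] at hi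
      exact (hP p hp).1.ne hi
    obtain ⟨j, rfl⟩ := Fin.exists_succ_eq.2 hi0
    rcases Fin.eq_castSucc_or_eq_last j with ⟨j', rfl⟩ | rfl
    · exact ⟨j', hi⟩
    · rw [Fin.succ_last, he1] at hi
      exact absurd hi.symm (hP p hp).2.ne
  refine ⟨g, hPg, ?_, ?_⟩
  · exact Finset.card_image_le.trans (by simp [g])
  · intro a b ha hab hb h
    obtain ⟨i, hi⟩ := g.exists_Ico_subset ha hab hb h
    have ha' := hi ⟨le_rfl, hab⟩
    refine ⟨e i.castSucc, (hQmem _ (hemem _)).1, ha'.1, ?_, ?_⟩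
    · intro t ht htm
      obtain ⟨j, hj⟩ := hsurj t (by simp [hQ, ht])
      have hb' : b ≤ e i.succ := by
        by_contra! hlt
        have := hi ⟨ha'.2.le, hlt⟩
        exact lt_irrefl _ this.2
      rw [← hj] at htm
      have h1 := e.lt_iff_lt.1 htm.1
      have h2 := e.lt_iff_lt.1 (htm.2.trans_le hb')
      rw [Fin.lt_def] at h1 h2
      simp only [Fin.val_castSucc, Fin.val_succ] at h1 h2
      omega
    · intro x hx
      rw [g.toFun_eq (hi hx)]
      change |v (e i.castSucc) + (if Even (i : ℕ) then 0 else θ) - v (e i.castSucc)| ≤ ν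
      rw [add_sub_cancel_left]
      split_ifs
      · simpa using hν.le
      · rw [abs_of_pos hθ0]; exact hθν.le

/-! ### Càdlàg functions: boundedness, large jumps, measurability -/

theorem IsCadlag.exists_right {f : ℝ → ℝ} (hf : IsCadlag f) {x ε : ℝ} (hx : x ∈ Set.Ico (0 : ℝ) 1)
    (hε : 0 < ε) : ∃ h, 0 < h ∧ x + h ≤ 1 ∧ ∀ y ∈ Set.Ico x (x + h), |f y - f x| ≤ ε := by
  have h1 : ∀ᶠ y in 𝓝[≥] x, |f y - f x| ≤ ε := by
    have := (hf.1 x hx).tendsto.eventually (Metric.closedBall_mem_nhds (f x) hε)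
    simpa [Real.dist_eq] using this
  obtain ⟨u, hu, hsub⟩ := mem_nhdsGE_iff_exists_Ico_subset.1 h1
  refine ⟨min u 1 - x, sub_pos.2 (lt_min hu hx.2), by simp, fun y hy => hsub ⟨hy.1, ?_⟩⟩
  have := hy.2
  rw [add_sub_cancel] at this
  exact this.trans_le (min_le_left _ _)

theorem IsCadlag.tendsto_leftLim {f : ℝ → ℝ} (hf : IsCadlag f) {x : ℝ}
    (hx : x ∈ Set.Ioc (0 : ℝ) 1) : Tendsto f (𝓝[<] x) (𝓝 (Function.leftLim f x)) := by
  obtain ⟨l, hl⟩ := hf.2 x hx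
  exact tendsto_leftLim_of_tendsto ⟨l, hl⟩

theorem IsCadlag.exists_left {f : ℝ → ℝ} (hf : IsCadlag f) {x ε : ℝ} (hx : x ∈ Set.Ioc (0 : ℝ) 1)
    (hε : 0 < ε) : ∃ h, 0 < h ∧ 0 ≤ x - h ∧
      ∀ y ∈ Set.Ico (x - h) x, |f y - Function.leftLim f x| ≤ ε := by
  have h1 : ∀ᶠ y in 𝓝[<] x, |f y - Function.leftLim f x| ≤ ε := by
    have := (hf.tendsto_leftLim hx).eventually (Metric.closedBall_mem_nhds _ hε)
    simpa [Real.dist_eq] using this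
  obtain ⟨u, hu, hsub⟩ := mem_nhdsLT_iff_exists_Ico_subset.1 h1
  refine ⟨x - max u 0, sub_pos.2 (max_lt hu hx.1), by simp, fun y hy => hsub ⟨?_, hy.2⟩⟩
  have := hy.1
  rw [sub_sub_cancel] at this
  exact (le_max_left _ _).trans this

/-- Covers every point of the compact `[0,1]`, so that local statements glue; at `0` and `1` the
missing side is vacuous and its constant arbitrary. -/
theorem IsCadlag.exists_two_sided {f : ℝ → ℝ} (hf : IsCadlag f) {x ε : ℝ}
    (hx : x ∈ Set.Icc (0 : ℝ) 1) (hε : 0 < ε) : ∃ h, 0 < h ∧ ∃ l v : ℝ,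
      (∀ y ∈ Set.Ico (0 : ℝ) 1, x - h < y → y < x → |f y - l| ≤ ε) ∧
      (∀ y ∈ Set.Ico (0 : ℝ) 1, x ≤ y → y < x + h → |f y - v| ≤ ε) := by
  obtain ⟨h₁, hh₁, l, hl⟩ : ∃ h, 0 < h ∧ ∃ l : ℝ,
      ∀ y ∈ Set.Ico (0 : ℝ) 1, x - h < y → y < x → |f y - l| ≤ ε := by
    rcases hx.1.eq_or_lt with rfl | h0
    · exact ⟨1, one_pos, 0, fun y hy _ h => absurd h (not_lt.2 hy.1)⟩
    · obtain ⟨h, hh, _, H⟩ := hf.exists_left ⟨h0, hx.2⟩ hε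
      exact ⟨h, hh, _, fun y _ h1 h2 => H y ⟨h1.le, h2⟩⟩
  obtain ⟨h₂, hh₂, v, hv⟩ : ∃ h, 0 < h ∧ ∃ v : ℝ,
      ∀ y ∈ Set.Ico (0 : ℝ) 1, x ≤ y → y < x + h → |f y - v| ≤ ε := by
    rcases hx.2.eq_or_lt with rfl | h0
    · exact ⟨1, one_pos, 0, fun y hy h _ => absurd hy.2 (not_lt.2 h)⟩
    · obtain ⟨h, hh, _, H⟩ := hf.exists_right ⟨hx.1, h0⟩ hε
      exact ⟨h, hh, _, fun y _ h1 h2 => H y ⟨h1, h2⟩⟩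
  refine ⟨min h₁ h₂, lt_min hh₁ hh₂, l, v, fun y hy h1 h2 => hl y hy ?_ h2,
    fun y hy h1 h2 => hv y hy h1 ?_⟩
  · linarith [min_le_left h₁ h₂]
  · linarith [min_le_right h₁ h₂]

theorem IsCadlag.exists_abs_le {f : ℝ → ℝ} (hf : IsCadlag f) :
    ∃ B : ℝ, ∀ x ∈ Set.Ico (0 : ℝ) 1, |f x| ≤ B := by
  have key : ∃ B : ℝ, ∀ x ∈ Set.Icc (0 : ℝ) 1 ∩ Set.Ico 0 1, |f x| ≤ B := by
    refine isCompact_Icc.induction_on (p := fun s => ∃ B : ℝ, ∀ x ∈ s ∩ Set.Ico 0 1, |f x| ≤ B)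
      ?_ ?_ ?_ ?_
    · exact ⟨0, by simp⟩
    · rintro s t hst ⟨B, hB⟩
      exact ⟨B, fun x hx => hB x ⟨hst hx.1, hx.2⟩⟩
    · rintro s t ⟨B, hB⟩ ⟨B', hB'⟩
      refine ⟨max B B', fun x hx => ?_⟩
      rcases hx.1 with h | h
      · exact (hB x ⟨h, hx.2⟩).trans (le_max_left _ _)
      · exact (hB' x ⟨h, hx.2⟩).trans (le_max_right _ _)
    · intro x hx
      obtain ⟨h, hh, l, v, hl, hv⟩ := hf.exists_two_sided hx one_pos
      refine ⟨Set.Ioo (x - h) (x + h), mem_nhdsWithin_of_mem_nhds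
        (Ioo_mem_nhds (by linarith) (by linarith)), max |l| |v| + 1, fun y hy => ?_⟩
      rcases lt_or_ge y x with hyx | hyx
      · have := hl y hy.2 hy.1.1 hyx
        have h2 := abs_sub_abs_le_abs_sub (f y) l
        linarith [le_max_left |l| |v|]
      · have := hv y hy.2 hyx hy.1.2
        have h2 := abs_sub_abs_le_abs_sub (f y) v
        linarith [le_max_right |l| |v|]
  obtain ⟨B, hB⟩ := key
  exact ⟨B, fun x hx => hB x ⟨Set.Ico_subset_Icc_self hx, hx⟩⟩

/-- Every point has a neighbourhood on each side of which `f` stays within `ε / 2` of a constant.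
Left limits inherit this, so only the point itself can carry a jump above `ε`; compactness does the
rest. -/
theorem IsCadlag.finite_jumpSet {f : ℝ → ℝ} (hf : IsCadlag f) {ε : ℝ} (hε : 0 < ε) :
    (jumpSet ε f).Finite := by
  have key : (Set.Icc (0 : ℝ) 1 ∩ jumpSet ε f).Finite := by
    refine isCompact_Icc.induction_on (p := fun s => (s ∩ jumpSet ε f).Finite) ?_ ?_ ?_ ?_
    · simp
    · intro s t hst ht
      exact ht.subset (Set.inter_subset_inter_left _ hst)
    · intro s t hs ht
      rw [Set.union_inter_distrib_right]
      exact hs.union ht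
    · intro x hx
      obtain ⟨h, hh, l, v, hl, hv⟩ := hf.exists_two_sided hx (half_pos hε)
      refine ⟨Set.Ioo (x - h) (x + h), mem_nhdsWithin_of_mem_nhds
        (Ioo_mem_nhds (by linarith) (by linarith)), (Set.finite_singleton x).subset ?_⟩
      rintro y ⟨hy, hy01, hjump⟩
      by_contra hne
      rw [Set.mem_singleton_iff] at hne
      have hlim := hf.tendsto_leftLim ⟨hy01.1, hy01.2.le⟩
      have aux : ∀ a w, a < y → (∀ z ∈ Set.Ico (0 : ℝ) 1, a < z → z ≤ y → |f z - w| ≤ ε / 2) →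
          False := by
        intro a w ha H
        have h1 : |Function.leftLim f y - w| ≤ ε / 2 := by
          refine le_of_tendsto ((hlim.sub_const w).abs) ?_
          filter_upwards [Ioo_mem_nhdsLT (max_lt ha hy01.1)] with z hz
          exact H z ⟨(le_max_right _ _).trans hz.1.le, hz.2.trans hy01.2⟩
            ((le_max_left _ _).trans_lt hz.1) hz.2.le
        have h2 := H y ⟨hy01.1.le, hy01.2⟩ ha le_rfl
        rw [abs_le] at h1 h2
        have : |f y - Function.leftLim f y| ≤ ε := by
          rw [abs_le]; constructor <;> linarith [h1.1, h1.2, h2.1, h2.2]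
        linarith
      rcases lt_or_gt_of_ne hne with hyx | hyx
      · exact aux (x - h) l hy.1 fun z hz h1 h2 => hl z hz h1 (h2.trans_lt hyx)
      · exact aux x v hyx fun z hz h1 h2 => hv z hz h1.le (h2.trans_lt hy.2)
  exact key.subset fun x hx => ⟨⟨hx.1.1.le, hx.1.2.le⟩, hx⟩

/-- By right-continuity `f` is the pointwise limit of its values at the next grid point to the
right, and these are functions of the measurable integer `⌊x (n + 1)⌋`. -/
theorem IsCadlag.measurable_indicator {f : ℝ → ℝ} (hf : IsCadlag f) :
    Measurable ((Set.Ico (0 : ℝ) 1).indicator f) := by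
  let F : ℕ → ℝ → ℝ := fun n =>
    (Set.Ico (0 : ℝ) 1).indicator fun x => f ((⌊x * (n + 1 : ℕ)⌋ + 1) / (n + 1 : ℕ))
  have hF : ∀ n, Measurable (F n) := by
    intro n
    refine Measurable.indicator ?_ measurableSet_Ico
    have h1 : Measurable fun x : ℝ => ⌊x * (n + 1 : ℕ)⌋ :=
      Int.measurable_floor.comp (measurable_id.mul_const _)
    exact (measurable_from_top (f := fun m : ℤ => f (((m : ℝ) + 1) / (n + 1 : ℕ)))).comp h1
  refine measurable_of_tendsto_metrizable hF (tendsto_pi_nhds.2 fun x => ?_)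
  by_cases hx : x ∈ Set.Ico (0 : ℝ) 1
  · simp only [F, Set.indicator_of_mem hx]
    have hbd : ∀ n : ℕ, x < ((⌊x * (n + 1 : ℕ)⌋ : ℝ) + 1) / (n + 1 : ℕ) ∧
        ((⌊x * (n + 1 : ℕ)⌋ : ℝ) + 1) / (n + 1 : ℕ) ≤ x + 1 / ((n : ℝ) + 1) := by
      intro n
      have hn : (0 : ℝ) < (n + 1 : ℕ) := by positivity
      constructor
      · rw [lt_div_iff₀ hn]
        exact Int.lt_floor_add_one _
      · rw [div_le_iff₀ hn]
        have := Int.floor_le (x * (n + 1 : ℕ))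
        push_cast at this ⊢
        have h2 : (x + 1 / ((n : ℝ) + 1)) * (n + 1) = x * (n + 1) + 1 := by field_simp
        linarith
    have hlim : Tendsto (fun n : ℕ => ((⌊x * (n + 1 : ℕ)⌋ : ℝ) + 1) / (n + 1 : ℕ)) atTop
        (𝓝[≥] x) := by
      refine tendsto_nhdsWithin_iff.2 ⟨?_, Eventually.of_forall fun n => (hbd n).1.le⟩
      refine tendsto_of_tendsto_of_tendsto_of_le_of_le tendsto_const_nhds ?_
        (fun n => (hbd n).1.le) (fun n => (hbd n).2)
      simpa using tendsto_one_div_add_atTop_nhds_zero_nat.const_add x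
    exact (hf.1 x hx).tendsto.comp hlim
  · simp only [F, Set.indicator_of_notMem hx]
    exact tendsto_const_nhds

theorem integrableOn_of_indicator {φ : ℝ → ℝ} {B : ℝ}
    (hm : Measurable ((Set.Ico (0 : ℝ) 1).indicator φ)) (hB : ∀ x ∈ Set.Ico (0 : ℝ) 1, |φ x| ≤ B) :
    IntegrableOn φ (Set.Ico 0 1) := by
  have hae : AEStronglyMeasurable φ (volume.restrict (Set.Ico (0 : ℝ) 1)) := by
    refine hm.aestronglyMeasurable.congr ?_
    exact indicator_ae_eq_restrict measurableSet_Ico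
  refine Integrable.of_bound hae B ?_
  exact (ae_restrict_iff' measurableSet_Ico).2 (Eventually.of_forall hB)

theorem IsCadlag.integrableOn {f : ℝ → ℝ} (hf : IsCadlag f) : IntegrableOn f (Set.Ico 0 1) := by
  obtain ⟨B, hB⟩ := hf.exists_abs_le
  exact integrableOn_of_indicator hf.measurable_indicator hB

theorem IsCadlag.integrableOn_sub_sq {f : ℝ → ℝ} (hf : IsCadlag f) (g : StepFunction) :
    IntegrableOn (fun x => (f x - g.toFun x) ^ 2) (Set.Ico 0 1) := by
  obtain ⟨B, hB⟩ := hf.exists_abs_le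
  obtain ⟨B', hB'⟩ := g.exists_abs_le
  refine integrableOn_of_indicator (B := (B + B') ^ 2) ?_ fun x hx => ?_
  · have : (Set.Ico (0 : ℝ) 1).indicator (fun x => (f x - g.toFun x) ^ 2) =
        (Set.Ico (0 : ℝ) 1).indicator
          (fun x => ((Set.Ico (0 : ℝ) 1).indicator f x - g.toFun x) ^ 2) := by
      ext x
      by_cases hx : x ∈ Set.Ico (0 : ℝ) 1 <;> simp [hx]
    rw [this]
    exact ((hf.measurable_indicator.sub g.measurable_toFun).pow_const 2).indicator
      measurableSet_Ico
  · rw [abs_of_nonneg (sq_nonneg _), ← sq_abs]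
    exact pow_le_pow_left₀ (abs_nonneg _)
      ((abs_sub _ _).trans (add_le_add (hB x hx) (hB' x))) 2

/-! ### Competitors with few jumps and small local bias -/

/-- A nonnegative function with total mass `E` on `[0,1)` admits at most `E / t` cut points such that
its mass between cut points is at most `t`. -/
theorem exists_cut_points {φ : ℝ → ℝ} (h0 : ∀ x, 0 ≤ φ x) (hφ : IntegrableOn φ (Set.Ico 0 1))
    {E t : ℝ} (ht : 0 < t) (hE : ∫ x in Set.Ico (0 : ℝ) 1, φ x ≤ E) :
    ∃ P : Finset ℝ, (∀ p ∈ P, p ∈ Set.Ioo (0 : ℝ) 1) ∧ (P.card : ℝ) ≤ E / t ∧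
      ∀ a b, 0 ≤ a → a ≤ b → b ≤ 1 → (∀ p ∈ P, p ∉ Set.Ioo a b) →
        ∫ x in Set.Ico a b, φ x ≤ t := by
  classical
  set ψ := (Set.Ico (0 : ℝ) 1).indicator φ with hψ
  have hψi : Integrable ψ := (integrable_indicator_iff measurableSet_Ico).2 hφ
  have hψ0 : ∀ x, 0 ≤ ψ x := fun x => Set.indicator_nonneg (fun x _ => h0 x) x
  set F : ℝ → ℝ := fun x => ∫ u in (0 : ℝ)..x, ψ u with hF
  have hFc : Continuous F := intervalIntegral.continuous_primitive
    (fun a b => hψi.intervalIntegrable) 0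
  have hsub : ∀ a b, 0 ≤ a → a ≤ b → b ≤ 1 → ∫ x in Set.Ico a b, φ x = F b - F a := by
    intro a b ha hab hb
    rw [hF]
    simp only
    rw [intervalIntegral.integral_interval_sub_left hψi.intervalIntegrable
      hψi.intervalIntegrable, intervalIntegral.integral_of_le hab, ← integral_Ico_eq_integral_Ioc]
    refine setIntegral_congr_fun measurableSet_Ico fun x hx => ?_
    have hx01 : x ∈ Set.Ico (0 : ℝ) 1 := ⟨ha.trans hx.1, hx.2.trans_le hb⟩
    exact (Set.indicator_of_mem hx01 φ).symm
  have hF0 : F 0 = 0 := by simp [hF]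
  have hF1 : F 1 ≤ E := by
    have := hsub 0 1 le_rfl zero_le_one le_rfl
    rw [hF0, sub_zero] at this
    rw [← this]; exact hE
  have hmono : ∀ a b, 0 ≤ a → a ≤ b → b ≤ 1 → F a ≤ F b := by
    intro a b ha hab hb
    have h1 := hsub a b ha hab hb
    have h2 : 0 ≤ ∫ x in Set.Ico a b, φ x := integral_nonneg h0
    linarith
  have hE0 : 0 ≤ E := by
    have := hmono 0 1 le_rfl zero_le_one le_rfl
    linarith
  have hivt : ∀ j : ℕ, (j : ℝ) * t ≤ F 1 → ∃ p ∈ Set.Icc (0 : ℝ) 1, F p = j * t := by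
    intro j hj
    have := intermediate_value_Icc (zero_le_one (α := ℝ)) hFc.continuousOn
    have hm := this (show (j : ℝ) * t ∈ Set.Icc (F 0) (F 1) from ⟨by rw [hF0]; positivity, hj⟩)
    obtain ⟨p, hp, hpj⟩ := hm
    exact ⟨p, hp, hpj⟩
  choose! p hp01 hpF using hivt
  -- Cuts are placed where the primitive `F` reaches multiples of `t`. The filter is needed because
  -- `p j` is arbitrary when `j * t` exceeds `F 1`.
  refine ⟨((Finset.Icc 1 ⌊E / t⌋₊).image p).filter (· ∈ Set.Ioo (0 : ℝ) 1), ?_, ?_, ?_⟩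
  · intro q hq
    exact (Finset.mem_filter.1 hq).2
  · refine (Nat.cast_le.2 ((Finset.card_filter_le _ _).trans Finset.card_image_le)).trans ?_
    rw [Nat.card_Icc, Nat.add_sub_cancel]
    exact Nat.floor_le (by positivity)
  · intro a b ha hab hb hP
    rw [hsub a b ha hab hb]
    by_contra! hlt
    have hFa : 0 ≤ F a := by rw [← hF0]; exact hmono 0 a le_rfl ha (hab.trans hb)
    -- The first multiple of `t` strictly above `F a`; it is below `F b` if `[a, b)` has mass above
    -- `t`.
    set j := ⌊F a / t⌋₊ + 1 with hj
    have hj1 : F a < j * t := by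
      rw [← div_lt_iff₀ ht, hj]
      exact_mod_cast Nat.lt_floor_add_one _
    have hj2 : (j : ℝ) * t ≤ F a + t := by
      have : (⌊F a / t⌋₊ : ℝ) * t ≤ F a := by
        rw [← le_div_iff₀ ht]
        exact Nat.floor_le (by positivity)
      rw [hj]; push_cast; linarith
    have hj3 : (j : ℝ) * t < F b := by linarith
    have hFb1 := hmono b 1 (ha.trans hab) hb le_rfl
    have hj4 : (j : ℝ) * t ≤ F 1 := by linarith
    have hpj := hp01 j hj4
    have hpFj := hpF j hj4
    have hap : a < p j := by
      by_contra! h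
      have := hmono _ _ hpj.1 h (hab.trans hb)
      linarith
    have hpb : p j < b := by
      by_contra! h
      have := hmono _ _ (ha.trans hab) h hpj.2
      linarith
    refine hP (p j) (Finset.mem_filter.2 ⟨Finset.mem_image.2 ⟨j, Finset.mem_Icc.2 ⟨by omega, ?_⟩,
      rfl⟩, ?_, ?_⟩) ⟨hap, hpb⟩
    · refine Nat.le_floor ?_
      rw [le_div_iff₀ ht]
      linarith
    · exact ha.trans_lt hap
    · exact hpb.trans_le hb

theorem abs_localMean_sub_le {f : ℝ → ℝ} {a b v ε : ℝ} (hab : a < b)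
    (hf : IntegrableOn f (Set.Ico a b)) (h : ∀ x ∈ Set.Ico a b, |f x - v| ≤ ε) :
    |localMean f (a, b) - v| ≤ ε := by
  have hba : 0 < b - a := sub_pos.2 hab
  have h1 : localMean f (a, b) - v = (∫ x in Set.Ico a b, (f x - v)) / (b - a) := by
    rw [integral_sub hf (integrableOn_const (by simp))]
    simp only [localMean]
    rw [setIntegral_const, Real.volume_real_Ico_of_le hab.le, smul_eq_mul]
    field_simp
  rw [h1, abs_div, abs_of_pos hba, div_le_iff₀ hba]
  have := norm_setIntegral_le_of_norm_le_const (μ := volume) (s := Set.Ico a b) (C := ε)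
    (f := fun x => f x - v) (by simp) h
  rwa [Real.volume_real_Ico_of_le hab.le] at this

/-- Jensen's inequality in tangent form: `(f - v)²` exceeds `2(m - v)(f - v) - (m - v)²` by exactly
`(f - m)²`. -/
theorem sq_localMean_sub_mul_le {f : ℝ → ℝ} {a b v : ℝ} (hab : a < b)
    (hf : IntegrableOn f (Set.Ico a b)) (hf2 : IntegrableOn (fun x => (f x - v) ^ 2) (Set.Ico a b)) :
    (localMean f (a, b) - v) ^ 2 * (b - a) ≤ ∫ x in Set.Ico a b, (f x - v) ^ 2 := by
  have hba : 0 < b - a := sub_pos.2 hab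
  set m := localMean f (a, b) with hm
  have hmf : ∫ x in Set.Ico a b, f x = m * (b - a) := by
    rw [hm]; simp only [localMean]; field_simp
  have hc : ∀ r : ℝ, IntegrableOn (fun _ : ℝ => r) (Set.Ico a b) := fun r =>
    integrableOn_const (by simp)
  have hlin : ∫ x in Set.Ico a b, (2 * (m - v) * f x) - (2 * (m - v) * v + (m - v) ^ 2) =
      (m - v) ^ 2 * (b - a) := by
    rw [integral_sub (hf.const_mul _) (hc _), integral_const_mul, hmf, setIntegral_const,
      Real.volume_real_Ico_of_le hab.le, smul_eq_mul]
    ring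
  rw [← hlin]
  refine integral_mono ((hf.const_mul _).sub (hc _)) hf2 fun x => ?_
  have := sq_nonneg (f x - m)
  simp only
  nlinarith

/-- A step function with few jumps whose local means deviate little from those of `f` on all
intervals of constancy. -/
theorem IsCadlag.exists_candidate {f : ℝ → ℝ} (hf : IsCadlag f) (g₀ : StepFunction) {E t : ℝ}
    (ht : 0 < t) (hE : ∫ x in Set.Ico (0 : ℝ) 1, (f x - g₀.toFun x) ^ 2 ≤ E) :
    ∃ g : StepFunction, (g.jumps.card : ℝ) ≤ g₀.jumps.card + E / t ∧
      ∀ a b c, 0 ≤ a → a < b → b ≤ 1 → (∀ x ∈ Set.Ico a b, g.toFun x = c) →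
        |localMean f (a, b) - c| * √(b - a) ≤ 2 * √t := by
  classical
  obtain ⟨P, hP01, hPcard, hP⟩ := exists_cut_points (fun x => sq_nonneg (f x - g₀.toFun x))
    (hf.integrableOn_sub_sq g₀) ht hE
  have hj01 : ∀ p ∈ g₀.jumps, p ∈ Set.Ioo (0 : ℝ) 1 := by
    intro p hp
    obtain ⟨i, rfl⟩ := g₀.mem_jumps.1 hp
    rw [← g₀.τ_zero, ← g₀.τ_last]
    exact ⟨g₀.τ_strictMono (by simp [Fin.lt_def]), g₀.τ_strictMono (by simp [Fin.lt_def])⟩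
  -- A perturbation of size `√t` costs no more than the approximation error, as intervals have
  -- length at most one; this is the second `√t` in the bound.
  obtain ⟨g, hPg, hcard, hg⟩ := exists_stepFunction (g₀.jumps ∪ P)
    (fun p hp => (Finset.mem_union.1 hp).elim (hj01 p) (hP01 p)) g₀.toFun (Real.sqrt_pos.2 ht)
  refine ⟨g, ?_, ?_⟩
  · have : (g.jumps.card : ℝ) ≤ g₀.jumps.card + P.card := by
      exact_mod_cast hcard.trans (Finset.card_union_le _ _)
    linarith
  · intro a b c ha hab hb hconst
    obtain ⟨p, hp0, hpa, hpP, hpv⟩ := hg a b ha hab hb (g.notMem_Ioo_of_const hconst)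
    set v := g₀.toFun p with hv
    have hg₀ : ∀ x ∈ Set.Ico a b, g₀.toFun x = v := fun x hx =>
      g₀.toFun_eq_of_no_jump hp0 (hpa.trans_lt hab) hb
        (fun t ht => hpP t (Finset.mem_union_left _ ht)) x ⟨hpa.trans hx.1, hx.2⟩
    have hcv : |v - c| ≤ √t := by
      have := hpv a ⟨le_rfl, hab⟩
      rwa [hconst a ⟨le_rfl, hab⟩, abs_sub_comm] at this
    have hsub : Set.Ico a b ⊆ Set.Ico 0 1 := Set.Ico_subset_Ico ha hb
    have heq : Set.EqOn (fun x => (f x - g₀.toFun x) ^ 2) (fun x => (f x - v) ^ 2)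
        (Set.Ico a b) := fun x hx => by simp only [hg₀ x hx]
    have h1 := sq_localMean_sub_mul_le (v := v) hab (hf.integrableOn.mono_set hsub)
      (((hf.integrableOn_sub_sq g₀).mono_set hsub).congr_fun heq measurableSet_Ico)
    rw [← setIntegral_congr_fun measurableSet_Ico heq] at h1
    have h2 := hP a b ha hab.le hb
      (fun q hq hqm => hpP q (Finset.mem_union_right _ hq) ⟨hpa.trans_lt hqm.1, hqm.2⟩)
    have h3 : |localMean f (a, b) - v| * √(b - a) ≤ √t := by
      refine Real.le_sqrt_of_sq_le ?_
      rw [mul_pow, sq_abs, Real.sq_sqrt (sub_pos.2 hab).le]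
      exact h1.trans h2
    have h4 : √(b - a) ≤ 1 := Real.sqrt_le_one.2 (by linarith)
    have h5 : |localMean f (a, b) - c| ≤ |localMean f (a, b) - v| + |v - c| := abs_sub_le _ _ _
    have h6 : |v - c| * √(b - a) ≤ √t := by
      calc |v - c| * √(b - a) ≤ √t * 1 :=
            mul_le_mul hcv h4 (Real.sqrt_nonneg _) (Real.sqrt_nonneg _)
        _ = √t := mul_one _
    nlinarith [Real.sqrt_nonneg (b - a)]

theorem ApproxClass.exists_stepFunction {γ L : ℝ} {f : ℝ → ℝ} (hL : 0 < L)
    (hf : f ∈ ApproxClass 2 γ L) {k : ℕ} (hk : 1 ≤ k) :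
    ∃ g : StepFunction, g.jumps.card ≤ k ∧
      ∫ x in Set.Ico (0 : ℝ) 1, (f x - g.toFun x) ^ 2 ≤ (2 * L) ^ 2 * (k : ℝ) ^ (-(2 * γ)) := by
  obtain ⟨hc, happ, -⟩ := hf
  have hk0 : (0 : ℝ) < k := by exact_mod_cast hk
  have hkγ : 0 < (k : ℝ) ^ γ := Real.rpow_pos_of_pos hk0 _
  -- The infimum need not be attained; the factor `2` leaves room for an actual step function.
  have hlt : approxError 2 k f < ENNReal.ofReal (2 * L * (k : ℝ) ^ (-γ)) := by
    by_contra! hge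
    have h1 := (mul_le_mul_right hge (ENNReal.ofReal ((k : ℝ) ^ γ))).trans (happ k hk)
    rw [← ENNReal.ofReal_mul hkγ.le] at h1
    have h2 := (ENNReal.ofReal_le_ofReal_iff hL.le).1 h1
    rw [Real.rpow_neg hk0.le] at h2
    field_simp at h2
    linarith
  unfold approxError at hlt
  simp only [iInf_lt_iff] at hlt
  obtain ⟨g, hg, hlt⟩ := hlt
  refine ⟨g, hg, ?_⟩
  have hint := hc.integrableOn_sub_sq g
  have h0 : 0 ≤ ∫ x in Set.Ico (0 : ℝ) 1, (f x - g.toFun x) ^ 2 :=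
    integral_nonneg fun x => sq_nonneg _
  rw [eLpNorm_eq_lintegral_rpow_enorm_toReal (by norm_num) (by norm_num)] at hlt
  have h2 : ∫⁻ x in Set.Ico (0 : ℝ) 1, ‖f x - g.toFun x‖ₑ ^ (2 : ℝ) =
      ENNReal.ofReal (∫ x in Set.Ico (0 : ℝ) 1, (f x - g.toFun x) ^ 2) := by
    rw [ofReal_integral_eq_lintegral_ofReal hint (Eventually.of_forall fun x => sq_nonneg _)]
    refine lintegral_congr fun x => ?_
    rw [← ofReal_norm, ENNReal.ofReal_rpow_of_nonneg (norm_nonneg _) (by norm_num)]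
    simp
  simp only [ENNReal.toReal_ofNat] at hlt
  rw [h2, ENNReal.ofReal_rpow_of_nonneg h0 (by norm_num)] at hlt
  have h3 := (ENNReal.ofReal_lt_ofReal_iff_of_nonneg (by positivity)).1 hlt
  rw [← Real.sqrt_eq_rpow] at h3
  have h4 := (Real.sqrt_lt' (by positivity)).1 h3
  refine h4.le.trans (le_of_eq ?_)
  rw [mul_pow, ← Real.rpow_natCast ((k : ℝ) ^ (-γ)), ← Real.rpow_mul hk0.le]
  congr 2
  push_cast; ring

/-! ### The multiscale statistic on grid intervals -/

open Classical in
/-- The indices of the observations in the interval `[I.1, I.2)`. -/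
noncomputable def cells (n : ℕ) (I : ℝ × ℝ) : Finset (Fin n) :=
  Finset.univ.filter fun i : Fin n => ((i : ℕ) : ℝ) / n ∈ Set.Ico I.1 I.2

theorem map_cells {n i j : ℕ} (hn : 1 ≤ n) (hj : j ≤ n) :
    (cells n ((i : ℝ) / n, (j : ℝ) / n)).map Fin.valEmbedding = Finset.Ico i j := by
  have hn0 : (0 : ℝ) < n := by exact_mod_cast hn
  ext l
  simp only [cells, Finset.mem_map, Finset.mem_filter, Finset.mem_univ, true_and, Set.mem_Ico,
    Fin.valEmbedding_apply, Finset.mem_Ico, div_le_div_iff_of_pos_right hn0,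
    div_lt_div_iff_of_pos_right hn0, Nat.cast_le, Nat.cast_lt]
  constructor
  · rintro ⟨a, ha, rfl⟩
    exact ha
  · intro h
    exact ⟨⟨l, by omega⟩, h, rfl⟩

theorem card_cells {n i j : ℕ} (hn : 1 ≤ n) (hij : i < j) (hj : j ≤ n) :
    ((cells n ((i : ℝ) / n, (j : ℝ) / n)).card : ℝ) = n * ((j : ℝ) / n - (i : ℝ) / n) := by
  have hn0 : (0 : ℝ) < n := by exact_mod_cast hn
  rw [← Finset.card_map Fin.valEmbedding, map_cells hn hj, Nat.card_Ico, Nat.cast_sub hij.le]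
  field_simp

theorem multiscaleStat_le_iff {n : ℕ} {𝓘 : Set (ℝ × ℝ)} {s : ℝ × ℝ → ℝ} {y : Fin n → ℝ}
    {g : ℝ → ℝ} {η : ℝ} :
    multiscaleStat n 𝓘 s y g ≤ (η : EReal) ↔
      ∀ I ∈ 𝓘, ∀ c : ℝ, (∀ x ∈ Set.Ico I.1 I.2, g x = c) →
        1 / √((n : ℝ) * (I.2 - I.1)) * |∑ i ∈ cells n I, (y i - c)| - s I ≤ η := by
  simp only [multiscaleStat, iSup_le_iff, EReal.coe_le_coe_iff, cells]

theorem IsNormalSystem.mem {c : ℝ} {n : ℕ} {𝓘 : Set (ℝ × ℝ)} (h : IsNormalSystem c n 𝓘)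
    (hn : 1 ≤ n) {I : ℝ × ℝ} (hI : I ∈ 𝓘) : 0 ≤ I.1 ∧ I.1 < I.2 ∧ I.2 ≤ 1 := by
  have hn0 : (0 : ℝ) < n := by exact_mod_cast hn
  obtain ⟨i, j, hij, hj, rfl⟩ := h.grid I hI
  refine ⟨by positivity, ?_, ?_⟩
  · exact (div_lt_div_iff_of_pos_right hn0).2 (by exact_mod_cast hij)
  · rw [div_le_one hn0]; exact_mod_cast hj

/-- There is no discretization error: observations are cell averages and the end-points of `I` lie
on the grid. -/
theorem sum_obs_sub {c : ℝ} {n : ℕ} {𝓘 : Set (ℝ × ℝ)} (h : IsNormalSystem c n 𝓘) (hn : 1 ≤ n)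
    {f : ℝ → ℝ} (hf : IntegrableOn f (Set.Ico 0 1)) {I : ℝ × ℝ} (hI : I ∈ 𝓘) (ξ : Fin n → ℝ)
    (v : ℝ) :
    ∑ l ∈ cells n I, (obs n f ξ l - v) =
      n * (I.2 - I.1) * (localMean f I - v) + ∑ l ∈ cells n I, ξ l := by
  have hn0 : (0 : ℝ) < n := by exact_mod_cast hn
  obtain ⟨h1, h2, h3⟩ := h.mem hn hI
  obtain ⟨i, j, hij, hj, rfl⟩ := h.grid I hI
  have hsum : ∑ l ∈ cells n ((i : ℝ) / n, (j : ℝ) / n),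
      (∫ x in Set.Ico (((l : ℕ) : ℝ) / n) ((((l : ℕ) : ℝ) + 1) / n), f x) =
      ∫ x in Set.Ico ((i : ℝ) / n) ((j : ℝ) / n), f x := by
    have e1 := Finset.sum_map (cells n ((i : ℝ) / n, (j : ℝ) / n)) Fin.valEmbedding
      (fun l : ℕ => ∫ x in ((l : ℝ) / n)..(((l + 1 : ℕ) : ℝ) / n), f x)
    rw [map_cells hn hj] at e1
    have e2 := intervalIntegral.sum_integral_adjacent_intervals_Ico (μ := volume) (f := f)
      (a := fun l : ℕ => (l : ℝ) / n) hij.le (fun l hl => by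
        rw [intervalIntegrable_iff_integrableOn_Ico_of_le
          ((div_le_div_iff_of_pos_right hn0).2 (by push_cast; linarith))]
        refine hf.mono_set (Set.Ico_subset_Ico (by positivity) ?_)
        rw [div_le_one hn0]
        exact_mod_cast (Nat.succ_le_of_lt hl.2).trans hj)
    rw [intervalIntegral.integral_of_le h2.le, ← integral_Ico_eq_integral_Ioc] at e2
    rw [← e2, e1]
    refine Finset.sum_congr rfl fun l _ => ?_
    simp only [Fin.valEmbedding_apply, Nat.cast_add, Nat.cast_one]
    rw [intervalIntegral.integral_of_le
      ((div_le_div_iff_of_pos_right hn0).2 (by linarith)), ← integral_Ico_eq_integral_Ioc]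
  simp only [obs, Finset.sum_sub_distrib, Finset.sum_add_distrib, Finset.sum_const, nsmul_eq_mul]
  rw [← Finset.mul_sum, hsum, card_cells hn hij hj, localMean]
  simp only at h2 ⊢
  have hd : (j : ℝ) / n - (i : ℝ) / n ≠ 0 := (sub_pos.2 h2).ne'
  generalize (j : ℝ) / n - (i : ℝ) / n = d at hd ⊢
  field_simp
  ring

theorem abs_localMean_sub_le_of_stat_le {c : ℝ} {n : ℕ} {𝓘 : Set (ℝ × ℝ)}
    (h : IsNormalSystem c n 𝓘) (hn : 1 ≤ n) {f : ℝ → ℝ} (hf : IntegrableOn f (Set.Ico 0 1))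
    {ξ : Fin n → ℝ} {s : ℝ × ℝ → ℝ} {g : ℝ → ℝ} {η B v : ℝ}
    (hT : multiscaleStat n 𝓘 s (obs n f ξ) g ≤ (η : EReal)) {I : ℝ × ℝ} (hI : I ∈ 𝓘)
    (hg : ∀ x ∈ Set.Ico I.1 I.2, g x = v)
    (hB : |∑ l ∈ cells n I, ξ l| ≤ B * √((n : ℝ) * (I.2 - I.1))) :
    |localMean f I - v| ≤ (η + s I + B) / √((n : ℝ) * (I.2 - I.1)) := by
  have hn0 : (0 : ℝ) < n := by exact_mod_cast hn
  obtain ⟨h1, h2, h3⟩ := h.mem hn hI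
  have hpos : 0 < (n : ℝ) * (I.2 - I.1) := mul_pos hn0 (sub_pos.2 h2)
  have hw := Real.sqrt_pos.2 hpos
  set w := √((n : ℝ) * (I.2 - I.1)) with hwdef
  have hww : w * w = n * (I.2 - I.1) := Real.mul_self_sqrt hpos.le
  have key := multiscaleStat_le_iff.1 hT I hI v hg
  rw [sum_obs_sub h hn hf hI, ← hwdef, ← hww] at key
  set d := localMean f I - v
  set X := ∑ l ∈ cells n I, ξ l
  have h4 : |w * w * d + X| ≤ (η + s I) * w := by
    rw [one_div, inv_mul_eq_div, sub_le_iff_le_add, div_le_iff₀ hw] at key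
    exact key
  have h5 : w * w * |d| ≤ |w * w * d + X| + |X| := by
    have := abs_sub (w * w * d + X) X
    rw [add_sub_cancel_right, abs_mul, abs_of_pos (mul_pos hw hw)] at this
    exact this
  rw [le_div_iff₀ hw]
  have h6 : (|d| * w) * w ≤ (η + s I + B) * w := by nlinarith
  exact le_of_mul_le_mul_right h6 hw

/-- Feasibility of a competitor: its bias adds at most `√n * t` to each normalized sum, which the
margin `q` left by the noise absorbs. -/
theorem multiscaleStat_le_of_close {c : ℝ} {n : ℕ} {𝓘 : Set (ℝ × ℝ)}
    (h : IsNormalSystem c n 𝓘) (hn : 1 ≤ n) {f : ℝ → ℝ} (hf : IntegrableOn f (Set.Ico 0 1))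
    {ξ : Fin n → ℝ} {s : ℝ × ℝ → ℝ} {g : ℝ → ℝ} {η q t : ℝ}
    (hξ : ∀ I ∈ 𝓘, |∑ l ∈ cells n I, ξ l| ≤ (η + s I - q) * √((n : ℝ) * (I.2 - I.1)))
    (hg : ∀ a b v, 0 ≤ a → a < b → b ≤ 1 → (∀ x ∈ Set.Ico a b, g x = v) →
      |localMean f (a, b) - v| * √(b - a) ≤ t) (htq : √n * t ≤ q) :
    multiscaleStat n 𝓘 s (obs n f ξ) g ≤ (η : EReal) := by
  have hn0 : (0 : ℝ) < n := by exact_mod_cast hn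
  refine multiscaleStat_le_iff.2 fun I hI v hv => ?_
  obtain ⟨h1, h2, h3⟩ := h.mem hn hI
  have hpos : 0 < (n : ℝ) * (I.2 - I.1) := mul_pos hn0 (sub_pos.2 h2)
  have hw := Real.sqrt_pos.2 hpos
  have hsplit : √((n : ℝ) * (I.2 - I.1)) = √n * √(I.2 - I.1) := Real.sqrt_mul hn0.le _
  have hd := hg I.1 I.2 v h1 h2 h3 hv
  have hX := hξ I hI
  rw [sum_obs_sub h hn hf hI]
  have hd2 : |localMean f I - v| * √((n : ℝ) * (I.2 - I.1)) ≤ q := by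
    rw [hsplit]
    calc |localMean f I - v| * (√n * √(I.2 - I.1))
        = √n * (|localMean f I - v| * √(I.2 - I.1)) := by ring
      _ ≤ √n * t := mul_le_mul_of_nonneg_left hd (Real.sqrt_nonneg _)
      _ ≤ q := htq
  set w := √((n : ℝ) * (I.2 - I.1)) with hwdef
  have hww : w * w = n * (I.2 - I.1) := Real.mul_self_sqrt hpos.le
  rw [← hww]
  set d := localMean f I - v
  set X := ∑ l ∈ cells n I, ξ l
  have h5 : |w * w * d + X| ≤ w * w * |d| + |X| := by
    refine (abs_add_le _ _).trans (le_of_eq ?_)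
    rw [abs_mul, abs_of_pos (mul_pos hw hw)]
  rw [one_div, inv_mul_eq_div, sub_le_iff_le_add, div_le_iff₀ hw]
  nlinarith

theorem abs_sum_le_of_nullStat_le {n : ℕ} {𝓘 : Set (ℝ × ℝ)} {c : ℝ} (h : IsNormalSystem c n 𝓘)
    (hn : 1 ≤ n) {s : ℝ × ℝ → ℝ} {ξ : Fin n → ℝ} {η : ℝ}
    (hT : multiscaleStat n 𝓘 s ξ StepFunction.zero.toFun ≤ (η : EReal)) {I : ℝ × ℝ} (hI : I ∈ 𝓘) :
    |∑ l ∈ cells n I, ξ l| ≤ (η + s I) * √((n : ℝ) * (I.2 - I.1)) := by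
  have hn0 : (0 : ℝ) < n := by exact_mod_cast hn
  obtain ⟨h1, h2, h3⟩ := h.mem hn hI
  have hw := Real.sqrt_pos.2 (mul_pos hn0 (sub_pos.2 h2))
  have key := multiscaleStat_le_iff.1 hT I hI 0 (fun x _ => by
    simp [StepFunction.toFun, StepFunction.zero])
  rw [one_div, inv_mul_eq_div, sub_le_iff_le_add, div_le_iff₀ hw] at key
  simpa using key

theorem nullStat_le_of_abs_sum_le {n : ℕ} {𝓘 : Set (ℝ × ℝ)} {c : ℝ} (h : IsNormalSystem c n 𝓘)
    (hn : 1 ≤ n) {s : ℝ × ℝ → ℝ} {ξ : Fin n → ℝ} {η : ℝ}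
    (hξ : ∀ I ∈ 𝓘, |∑ l ∈ cells n I, ξ l| ≤ (η + s I) * √((n : ℝ) * (I.2 - I.1))) :
    multiscaleStat n 𝓘 s ξ StepFunction.zero.toFun ≤ (η : EReal) := by
  have hn0 : (0 : ℝ) < n := by exact_mod_cast hn
  refine multiscaleStat_le_iff.2 fun I hI v hv => ?_
  obtain ⟨h1, h2, h3⟩ := h.mem hn hI
  have hw := Real.sqrt_pos.2 (mul_pos hn0 (sub_pos.2 h2))
  have hv0 : v = 0 := by
    rw [← hv I.1 ⟨le_rfl, h2⟩]
    simp [StepFunction.toFun, StepFunction.zero]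
  rw [one_div, inv_mul_eq_div, sub_le_iff_le_add, div_le_iff₀ hw]
  simpa [hv0] using hξ I hI

/-! ### Sub-Gaussian tails and the union bound -/

theorem hasSubgaussianMGF_mono {Ω : Type*} [MeasurableSpace Ω] {μ : Measure Ω} {X : Ω → ℝ}
    {a b : ℝ≥0} (h : HasSubgaussianMGF X a μ) (hab : a ≤ b) : HasSubgaussianMGF X b μ where
  integrable_exp_mul := h.integrable_exp_mul
  mgf_le t := (h.mgf_le t).trans (by gcongr)

/-- The scale `v ≥ σ` is kept free because `σ` may be `0`, where the exponent with `σ` in place of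
`v` would be a division by zero. -/
theorem IsNoise.measure_sum_gt_le {Ω : Type*} [MeasurableSpace Ω] {μ : Measure Ω}
    [IsProbabilityMeasure μ] {σ : ℝ≥0} {n : ℕ} {ξ : Fin n → Ω → ℝ} (h : IsNoise μ σ n ξ) {v : ℝ≥0}
    (hσv : σ ≤ v) (S : Finset (Fin n)) {x : ℝ} (hx : 0 ≤ x) :
    μ {ω | x * √(S.card) < |∑ l ∈ S, ξ l ω|} ≤
      ENNReal.ofReal (2 * Real.exp (-x ^ 2 / (2 * v ^ 2))) := by
  rcases S.eq_empty_or_nonempty with rfl | hS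
  · simp
  have hc : (0 : ℝ) < S.card := by exact_mod_cast hS.card_pos
  have hsub : ∀ i, HasSubgaussianMGF (ξ i) (v ^ 2) μ := fun i =>
    hasSubgaussianMGF_mono (h.subgaussian i) (by gcongr)
  have hexp : Real.exp (-(x * √(S.card)) ^ 2 / (2 * ((∑ _i ∈ S, v ^ 2 : ℝ≥0) : ℝ))) =
      Real.exp (-x ^ 2 / (2 * v ^ 2)) := by
    congr 1
    rw [mul_pow, Real.sq_sqrt hc.le, Finset.sum_const, nsmul_eq_mul]
    push_cast
    rw [show -(x ^ 2 * (S.card : ℝ)) = (S.card : ℝ) * -x ^ 2 by ring,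
      show 2 * ((S.card : ℝ) * (v : ℝ) ^ 2) = (S.card : ℝ) * (2 * (v : ℝ) ^ 2) by ring,
      mul_div_mul_left _ _ hc.ne']
  have h1 := HasSubgaussianMGF.measure_sum_ge_le_of_iIndepFun h.indep (s := S)
    (fun i _ => hsub i) (mul_nonneg hx (Real.sqrt_nonneg (S.card : ℝ)))
  have hindep' : iIndepFun (fun i => -ξ i) μ :=
    h.indep.comp (fun _ => Neg.neg) (fun _ => measurable_neg)
  have h2 := HasSubgaussianMGF.measure_sum_ge_le_of_iIndepFun hindep' (s := S)
    (fun i _ => (hsub i).neg) (mul_nonneg hx (Real.sqrt_nonneg (S.card : ℝ)))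
  rw [hexp] at h1 h2
  have h3 : μ.real {ω | x * √(S.card) < |∑ l ∈ S, ξ l ω|} ≤
      2 * Real.exp (-x ^ 2 / (2 * v ^ 2)) := by
    rw [two_mul]
    refine le_trans ?_ (add_le_add h1 h2)
    refine (measureReal_mono (fun ω hω => ?_) (by finiteness)).trans (measureReal_union_le _ _)
    rcases lt_abs.1 (Set.mem_ofPred.1 hω) with hlt | hlt
    · exact Or.inl hlt.le
    · refine Or.inr ?_
      simpa using hlt.le
  rw [← ofReal_measureReal (by finiteness)]
  exact ENNReal.ofReal_le_ofReal h3

/-- At most `(n + 1)² ≤ 4 n²` pairs of grid points matter, each with tail `2 n^(-κ² / (2 v²))`. -/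
theorem IsNoise.measure_exists_sum_gt_le {Ω : Type*} [MeasurableSpace Ω] {μ : Measure Ω}
    [IsProbabilityMeasure μ] {σ : ℝ≥0} {n : ℕ} {ξ : Fin n → Ω → ℝ} (h : IsNoise μ σ n ξ)
    {c : ℝ} {𝓘 : Set (ℝ × ℝ)} (h𝓘 : IsNormalSystem c n 𝓘) (hn : 1 ≤ n) {v : ℝ≥0}
    (hσv : σ ≤ v) {κ : ℝ} (hκ : 0 ≤ κ) :
    μ {ω | ∃ I ∈ 𝓘, κ * √(Real.log n) * √((n : ℝ) * (I.2 - I.1)) < |∑ l ∈ cells n I, ξ l ω|} ≤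
      ENNReal.ofReal (8 * (n : ℝ) ^ (2 - κ ^ 2 / (2 * v ^ 2))) := by
  have hn1 : (1 : ℝ) ≤ n := by exact_mod_cast hn
  have hn0 : (0 : ℝ) < n := by linarith
  have hlog : 0 ≤ Real.log n := Real.log_nonneg hn1
  have hB : 0 ≤ κ * √(Real.log n) := mul_nonneg hκ (Real.sqrt_nonneg _)
  set R := Finset.range (n + 1) ×ˢ Finset.range (n + 1) with hR
  let A : ℕ × ℕ → Set Ω := fun p =>
    {ω | κ * √(Real.log n) * √((cells n ((p.1 : ℝ) / n, (p.2 : ℝ) / n)).card) <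
      |∑ l ∈ cells n ((p.1 : ℝ) / n, (p.2 : ℝ) / n), ξ l ω|}
  have hsub : {ω | ∃ I ∈ 𝓘, κ * √(Real.log n) * √((n : ℝ) * (I.2 - I.1)) <
      |∑ l ∈ cells n I, ξ l ω|} ⊆ ⋃ p ∈ R, A p := by
    rintro ω ⟨I, hI, hω⟩
    obtain ⟨i, j, hij, hj, rfl⟩ := h𝓘.grid I hI
    refine Set.mem_iUnion₂.2 ⟨(i, j), ?_, ?_⟩
    · simp only [hR, Finset.mem_product, Finset.mem_range]
      omega
    · simp only [A, Set.mem_ofPred]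
      rw [card_cells hn hij hj]
      exact hω
  refine (measure_mono hsub).trans ((measure_biUnion_finset_le _ _).trans ?_)
  refine (Finset.sum_le_sum fun p _ => h.measure_sum_gt_le hσv _ hB).trans ?_
  rw [Finset.sum_const, nsmul_eq_mul, ← ENNReal.ofReal_natCast,
    ← ENNReal.ofReal_mul (Nat.cast_nonneg _)]
  refine ENNReal.ofReal_le_ofReal ?_
  have hexp : Real.exp (-(κ * √(Real.log n)) ^ 2 / (2 * v ^ 2)) =
      (n : ℝ) ^ (-(κ ^ 2 / (2 * v ^ 2))) := by
    rw [Real.rpow_def_of_pos hn0, mul_pow, Real.sq_sqrt hlog]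
    congr 1
    ring
  rw [hexp, sub_eq_add_neg, Real.rpow_add hn0, hR, Finset.card_product, Finset.card_range]
  have hp : 0 < (n : ℝ) ^ (-(κ ^ 2 / (2 * (v : ℝ) ^ 2))) := Real.rpow_pos_of_pos hn0 _
  rw [Real.rpow_ofNat]
  push_cast
  have : ((n : ℝ) + 1) * (n + 1) ≤ 4 * n ^ 2 := by nlinarith
  nlinarith

/-! ### Deterministic consequences of closeness: values, modes, jumps -/

/-- On every interval of the system on which `g` is constant, its value is within
`A / √(n |I|)` of the local mean of `f`. -/
def IsClose (n : ℕ) (𝓘 : Set (ℝ × ℝ)) (A : ℝ) (f : ℝ → ℝ) (g : StepFunction) : Prop :=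
  ∀ I ∈ 𝓘, ∀ v, (∀ x ∈ Set.Ico I.1 I.2, g.toFun x = v) →
    |localMean f I - v| ≤ A / √((n : ℝ) * (I.2 - I.1))

/-- Normality supplies an interval of the system inside `[a, b)` with at least `B` observations. One
`ε` is the oscillation of `f`, the other the statistical error `A / √B`; `1 < B` makes `[a, b)` long
enough for normality to apply. -/
theorem IsClose.abs_sub_le_of_no_jump {c : ℝ} (hc : 0 < c) {n : ℕ} {𝓘 : Set (ℝ × ℝ)}
    (h : IsNormalSystem c n 𝓘) (hn : 1 ≤ n) {f : ℝ → ℝ} (hf : IntegrableOn f (Set.Ico 0 1))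
    {g : StepFunction} {A B a b v ε : ℝ} (hg : IsClose n 𝓘 A f g) (ha : 0 ≤ a) (hab : a < b)
    (hb : b ≤ 1) (hjump : ∀ t ∈ g.jumps, t ∉ Set.Ioo a b)
    (hv : ∀ x ∈ Set.Ico a b, |f x - v| ≤ ε) (hB : B ≤ n * (b - a) / c) (hB1 : 1 < B)
    (hA : A ≤ ε * √B) : |g.toFun a - v| ≤ 2 * ε := by
  have hn0 : (0 : ℝ) < n := by exact_mod_cast hn
  have hε : 0 ≤ ε := (abs_nonneg _).trans (hv a ⟨le_rfl, hab⟩)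
  have hrich : c / n < b - a := by
    rw [div_lt_iff₀ hn0]
    have := hB1.trans_le hB
    rw [lt_div_iff₀ hc] at this
    linarith
  obtain ⟨I, hI, hsub, hlen⟩ := h.rich a b ha hab hb hrich
  obtain ⟨h1, h2, h3⟩ := h.mem hn hI
  have hconst := g.toFun_eq_of_no_jump ha hab hb hjump
  have k1 := hg I hI (g.toFun a) fun x hx => hconst x (hsub hx)
  have k2 : |localMean f I - v| ≤ ε := abs_localMean_sub_le h2
    (hf.mono_set (Set.Ico_subset_Ico h1 h3)) fun x hx => hv x (hsub hx)
  have hBI : B ≤ n * (I.2 - I.1) := by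
    refine hB.trans ?_
    have := mul_le_mul_of_nonneg_left hlen hn0.le
    refine le_trans (le_of_eq ?_) this
    field_simp
  have hsqB : 0 < √B := Real.sqrt_pos.2 (by linarith)
  have hsq : √B ≤ √((n : ℝ) * (I.2 - I.1)) := Real.sqrt_le_sqrt hBI
  have k3 : A / √((n : ℝ) * (I.2 - I.1)) ≤ ε := by
    rw [div_le_iff₀ (hsqB.trans_le hsq)]
    exact hA.trans (mul_le_mul_of_nonneg_left hsq hε)
  have k4 := abs_sub_le (g.toFun a) (localMean f I) v
  rw [abs_sub_comm (g.toFun a) (localMean f I)] at k4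
  linarith

/-- Among `m + 1` disjoint subintervals of equal length, one contains none of `m` given points. -/
theorem exists_subinterval_without (S : Finset ℝ) {x h : ℝ} (hh : 0 < h) :
    ∃ a b, x ≤ a ∧ b ≤ x + h ∧ b - a = h / (S.card + 1) ∧ ∀ t ∈ S, t ∉ Set.Ioo a b := by
  set m := S.card with hm
  have hm0 : (0 : ℝ) < m + 1 := by positivity
  set w := h / ((m : ℝ) + 1) with hw
  have hw0 : 0 < w := div_pos hh hm0
  have hwm : w * (m + 1) = h := by rw [hw]; field_simp
  by_contra! H
  -- Pigeonhole: otherwise each of `m + 1` disjoint open pieces would contain one of only `m`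
  -- points.
  have key : ∀ i ∈ Finset.range (m + 1), ∃ t ∈ S, t ∈ Set.Ioo (x + i * w) (x + (i + 1) * w) := by
    intro i hi
    have hi' : (i : ℝ) + 1 ≤ m + 1 := by
      exact_mod_cast Nat.succ_le_of_lt (Finset.mem_range.1 hi)
    refine H _ _ ?_ ?_ (by ring)
    · have : 0 ≤ (i : ℝ) * w := by positivity
      linarith
    · nlinarith
  choose! φ hφS hφ using key
  obtain ⟨i, hi, j, hj, hij, heq⟩ := Finset.exists_ne_map_eq_of_card_lt_of_maps_to
    (s := Finset.range (m + 1)) (t := S) (f := φ) (by simp [hm]) hφS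
  have aux : ∀ i ∈ Finset.range (m + 1), ∀ j ∈ Finset.range (m + 1), i < j → φ i = φ j → False := by
    intro i hi j hj hij heq
    have h1 := (hφ i hi).2
    have h2 := (hφ j hj).1
    rw [heq] at h1
    have : (i : ℝ) + 1 ≤ j := by exact_mod_cast hij
    nlinarith
  rcases lt_or_gt_of_ne hij with hlt | hlt
  · exact aux i hi j hj hlt heq
  · exact aux j hj i hi hlt heq.symm

theorem IsClose.exists_abs_sub_le {c : ℝ} (hc : 0 < c) {n : ℕ} {𝓘 : Set (ℝ × ℝ)}
    (hI : IsNormalSystem c n 𝓘) (hn : 1 ≤ n) {f : ℝ → ℝ} (hf : IntegrableOn f (Set.Ico 0 1))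
    {g : StepFunction} {A B k x h v ε : ℝ} (hg : IsClose n 𝓘 A f g) (hx : 0 ≤ x) (hh : 0 < h)
    (hxh : x + h ≤ 1) (hk : (g.jumps.card : ℝ) ≤ k)
    (hv : ∀ y ∈ Set.Ico x (x + h), |f y - v| ≤ ε) (hB : B = n * (h / (k + 1)) / c) (hB1 : 1 < B)
    (hA : A ≤ ε * √B) : ∃ p ∈ Set.Ico x (x + h), |g.toFun p - v| ≤ 2 * ε := by
  obtain ⟨a, b, hxa, hbh, hba, hS⟩ := exists_subinterval_without g.jumps (x := x) hh
  have hab : a < b := by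
    rw [← sub_pos, hba]; positivity
  refine ⟨a, ⟨hxa, hab.trans_le hbh⟩, hg.abs_sub_le_of_no_jump hc hI hn hf (hx.trans hxa) hab
    (hbh.trans hxh) hS (fun y hy => hv y ⟨hxa.trans hy.1, hy.2.trans_le hbh⟩) ?_ hB1 hA⟩
  rw [hB, hba]
  gcongr

/-- Here `B` stands for a lower bound on the number of observations in a usable interval; it only
has to outgrow `log n`. -/
theorem eventually_one_lt_and_le_sqrt {B : ℕ → ℝ} (hB0 : ∀ᶠ n in atTop, 0 < B n)
    (hB : Tendsto (fun n : ℕ => Real.log n / B n) atTop (𝓝 0)) {K ε : ℝ} (hε : 0 < ε) :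
    ∀ᶠ n : ℕ in atTop, 1 < B n ∧ K * √(Real.log n) ≤ ε * √(B n) := by
  have hlog : Tendsto (fun n : ℕ => Real.log n) atTop atTop :=
    Real.tendsto_log_atTop.comp tendsto_natCast_atTop_atTop
  have hK : 0 < (ε / (|K| + 1)) ^ 2 := by positivity
  filter_upwards [hB0, hlog.eventually_gt_atTop 1, hB.eventually_lt_const one_pos,
    hB.eventually_lt_const hK] with n h0 h1 h2 h3
  rw [div_lt_iff₀ h0] at h2 h3
  refine ⟨by linarith, ?_⟩
  have h4 : √(Real.log n) ≤ ε / (|K| + 1) * √(B n) := by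
    rw [← Real.sqrt_sq (show 0 ≤ ε / (|K| + 1) by positivity), ← Real.sqrt_mul hK.le]
    exact Real.sqrt_le_sqrt h3.le
  calc K * √(Real.log n) ≤ (|K| + 1) * √(Real.log n) := by
        gcongr; linarith [le_abs_self K]
    _ ≤ (|K| + 1) * (ε / (|K| + 1) * √(B n)) := by gcongr
    _ = ε * √(B n) := by field_simp

theorem tendsto_log_div_natCast_rpow {θ : ℝ} (hθ : 0 < θ) :
    Tendsto (fun n : ℕ => Real.log n / (n : ℝ) ^ θ) atTop (𝓝 0) :=
  (isLittleO_log_rpow_atTop hθ).tendsto_div_nhds_zero.comp tendsto_natCast_atTop_atTop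

theorem tendsto_log_div_natCast : Tendsto (fun n : ℕ => Real.log n / n) atTop (𝓝 0) := by
  simpa using tendsto_log_div_natCast_rpow one_pos

/-- A function close to `f` with few jumps nearly attains the value `f x` shortly after `x`. -/
theorem eventually_exists_abs_sub_le {c : ℝ} (hc : 0 < c) {𝓘 : ℕ → Set (ℝ × ℝ)}
    (h𝓘 : ∀ n, 1 ≤ n → IsNormalSystem c n (𝓘 n)) {f : ℝ → ℝ} (hf : IsCadlag f) {K D θ : ℝ}
    (hD : 0 < D) (hθ : θ < 1) {x e : ℝ} (hx : x ∈ Set.Ico (0 : ℝ) 1) (he : 0 < e) :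
    ∀ᶠ n : ℕ in atTop, ∀ g : StepFunction, IsClose n (𝓘 n) (K * √(Real.log n)) f g →
      (g.jumps.card : ℝ) ≤ D * (n : ℝ) ^ θ →
        ∃ p ∈ Set.Ico x (x + e), p < 1 ∧ |g.toFun p - f x| ≤ e := by
  obtain ⟨h', hh', hxh', hfx⟩ := hf.exists_right hx (half_pos he)
  set h := min h' e with hh
  have hh0 : 0 < h := lt_min hh' he
  have hxh : x + h ≤ 1 := by linarith [min_le_left h' e]
  -- Up to the normality constant, the number of observations in the jump-free piece; it outgrows
  -- `log n` because `θ < 1`.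
  let B : ℕ → ℝ := fun n => n * (h / (D * (n : ℝ) ^ θ + 1)) / c
  have hB0 : ∀ᶠ n in atTop, 0 < B n := by
    filter_upwards [eventually_ge_atTop 1] with n hn
    have : (0 : ℝ) < n := by exact_mod_cast hn
    simp only [B]
    positivity
  have hB : Tendsto (fun n : ℕ => Real.log n / B n) atTop (𝓝 0) := by
    have h1 := ((tendsto_log_div_natCast_rpow (sub_pos.2 hθ)).const_mul (c * D / h)).add
      (tendsto_log_div_natCast.const_mul (c / h))
    rw [mul_zero, mul_zero, add_zero] at h1
    refine h1.congr' ?_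
    filter_upwards [eventually_ge_atTop 1] with n hn
    have hn0 : (0 : ℝ) < n := by exact_mod_cast hn
    have hpos : 0 < (n : ℝ) ^ θ := Real.rpow_pos_of_pos hn0 _
    simp only [B]
    rw [Real.rpow_sub hn0, Real.rpow_one]
    field_simp
  filter_upwards [eventually_one_lt_and_le_sqrt hB0 hB (K := K) (half_pos he),
    eventually_ge_atTop 1] with n hBn hn g hg hk
  obtain ⟨p, hp, hpv⟩ := hg.exists_abs_sub_le hc (h𝓘 n hn) hn hf.integrableOn hx.1 hh0 hxh hk
    (v := f x) (ε := e / 2) (fun y hy => hfx y ⟨hy.1, hy.2.trans_le (by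
      linarith [min_le_left h' e])⟩) rfl hBn.1 hBn.2
  refine ⟨p, ⟨hp.1, hp.2.trans_le (by linarith [min_le_right h' e])⟩, hp.2.trans_le hxh, ?_⟩
  linarith

/-- Modes are inherited by functions that nearly attain each value of `f` shortly after it is attained
by `f`. -/
theorem HasModes.eventually {f : ℝ → ℝ} {m : ℕ} (hm : HasModes f m) {P : ℕ → (ℝ → ℝ) → Prop}
    (hP : ∀ e : ℝ, 0 < e → ∀ x ∈ Set.Ico (0 : ℝ) 1, ∀ᶠ n in atTop, ∀ φ, P n φ →
      ∃ p ∈ Set.Ico x (x + e), p < 1 ∧ |φ p - f x| ≤ e) :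
    ∀ᶠ n in atTop, ∀ φ, P n φ → HasModes φ m := by
  obtain ⟨x, y, hx, hxy⟩ := hm
  have hy : ∀ i, y i ∈ Set.Ico (0 : ℝ) 1 := fun i =>
    ⟨(hx i.castSucc).1.trans (hxy i).1.le, (hxy i).2.1.trans (hx i.succ).2⟩
  have small : ∀ {r : ℝ}, 0 < r → ∀ᶠ e in 𝓝[>] (0 : ℝ), e < r := fun hr =>
    mem_nhdsWithin_of_mem_nhds (Iio_mem_nhds hr)
  -- Below all spacings and half of all height differences, `e` preserves the order of the shifted
  -- points and the strict inequalities.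
  have hev : ∀ᶠ e in 𝓝[>] (0 : ℝ), 0 < e ∧ ∀ i : Fin m, e < y i - x i.castSucc ∧
      e < x i.succ - y i ∧ e < (f (y i) - f (x i.castSucc)) / 2 ∧
      e < (f (y i) - f (x i.succ)) / 2 := by
    refine (eventually_mem_nhdsWithin.mono fun e he => he).and (eventually_all.2 fun i => ?_)
    obtain ⟨h1, h2, h3, h4⟩ := hxy i
    exact (small (by linarith)).and ((small (by linarith)).and
      ((small (by linarith)).and (small (by linarith))))
  obtain ⟨e, he, hei⟩ := hev.exists
  filter_upwards [eventually_all.2 fun i => hP e he (x i) (hx i),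
    eventually_all.2 fun i => hP e he (y i) (hy i)] with n hnx hny φ hφ
  choose p hp hp1 hpv using fun i => hnx i φ hφ
  choose q hq hq1 hqv using fun i => hny i φ hφ
  refine ⟨p, q, fun i => ⟨(hx i).1.trans (hp i).1, hp1 i⟩, fun i => ?_⟩
  obtain ⟨h1, h2, h3, h4⟩ := hei i
  have a1 := abs_le.1 (hpv i.castSucc)
  have a2 := abs_le.1 (hpv i.succ)
  have a3 := abs_le.1 (hqv i)
  have b1 := (hp i.castSucc).2
  have b2 := (hp i.succ).1
  have b3 := hq i
  refine ⟨by linarith [b3.1], by linarith [b3.2], by linarith [a1.2, a3.1],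
    by linarith [a2.2, a3.1]⟩

/-- `M = 0` is separate: a positive `M` is reached through `M - 1` being strictly below the
supremum. -/
theorem exists_hasModes_of_le_numModes {f : ℝ → ℝ} {M : ℕ} (h : (M : ℕ∞) ≤ numModes f)
    (hne : ∃ x : ℝ, x ∈ Set.Ico (0 : ℝ) 1) : ∃ m, M ≤ m ∧ HasModes f m := by
  cases M with
  | zero =>
    obtain ⟨x, hx⟩ := hne
    exact ⟨0, le_rfl, fun _ => x, fun i => i.elim0, fun _ => hx, fun i => i.elim0⟩
  | succ M =>
    have hlt : (M : ℕ∞) < numModes f := lt_of_lt_of_le (by exact_mod_cast Nat.lt_succ_self M) h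
    unfold numModes at hlt
    simp only [lt_iSup_iff] at hlt
    obtain ⟨m, hm, hlt⟩ := hlt
    exact ⟨m, by exact_mod_cast hlt, hm⟩

theorem HasModes.le_numModes {f : ℝ → ℝ} {M m : ℕ} (h : HasModes f m) (hM : M ≤ m) :
    (M : ℕ∞) ≤ numModes f :=
  (Nat.cast_le.2 hM).trans (le_iSup₂ (f := fun (m : ℕ) (_ : HasModes f m) => (m : ℕ∞)) m h)

theorem le_minJump {ε : ℝ} {f : ℝ → ℝ} (h : (jumpSet ε f).Nonempty) : ε ≤ minJump ε f := by
  refine le_csInf (h.image _) ?_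
  rintro _ ⟨x, hx, rfl⟩
  exact hx.2.le

/-- Otherwise `g` is constant on `[t - w, t + w)` and its value is within `ε / 4` of both the left
limit and the value of `f` at `t`, contradicting a jump above `ε`. -/
theorem eventually_exists_jump_near {c : ℝ} (hc : 0 < c) {𝓘 : ℕ → Set (ℝ × ℝ)}
    (h𝓘 : ∀ n, 1 ≤ n → IsNormalSystem c n (𝓘 n)) {f : ℝ → ℝ} (hf : IsCadlag f) {K ε t : ℝ}
    (hε : 0 < ε) (ht : t ∈ jumpSet ε f) {w : ℕ → ℝ} (hw0 : ∀ᶠ n in atTop, 0 < w n)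
    (hw : Tendsto w atTop (𝓝 0))
    (hwlog : Tendsto (fun n : ℕ => Real.log n / (n * w n / c)) atTop (𝓝 0)) :
    ∀ᶠ n : ℕ in atTop, ∀ g : StepFunction, IsClose n (𝓘 n) (K * √(Real.log n)) f g →
      ∃ t' ∈ g.jumps, |t - t'| ≤ w n := by
  obtain ⟨⟨ht0, ht1⟩, htε⟩ := ht
  have hε8 : 0 < ε / 8 := by positivity
  obtain ⟨h₁, hh₁, hh₁t, hleft⟩ := hf.exists_left ⟨ht0, ht1.le⟩ hε8
  obtain ⟨h₂, hh₂, hh₂t, hright⟩ := hf.exists_right ⟨ht0.le, ht1⟩ hε8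
  have hB0 : ∀ᶠ n : ℕ in atTop, 0 < n * w n / c := by
    filter_upwards [hw0, eventually_ge_atTop 1] with n h hn
    have : (0 : ℝ) < n := by exact_mod_cast hn
    positivity
  filter_upwards [hw0, hw.eventually_lt_const hh₁, hw.eventually_lt_const hh₂,
    eventually_one_lt_and_le_sqrt hB0 hwlog (K := K) hε8, eventually_ge_atTop 1]
    with n hn0 hn1 hn2 hB hn g hg
  by_contra! H
  have hno : ∀ s ∈ g.jumps, s ∉ Set.Ioo (t - w n) (t + w n) := by
    intro s hs hsm
    have := H s hs
    rw [lt_abs] at this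
    rcases this with h | h <;> linarith [hsm.1, hsm.2]
  have hconst := g.toFun_eq_of_no_jump (by linarith) (by linarith) (by linarith) hno t
    ⟨by linarith, by linarith⟩
  have k1 := hg.abs_sub_le_of_no_jump hc (h𝓘 n hn) hn hf.integrableOn (a := t - w n) (b := t)
    (by linarith) (by linarith) ht1.le
    (fun s hs hsm => hno s hs ⟨hsm.1, by linarith [hsm.2]⟩)
    (fun x hx => hleft x ⟨by linarith [hx.1], hx.2⟩) (by rw [sub_sub_cancel]) hB.1 hB.2
  have k2 := hg.abs_sub_le_of_no_jump hc (h𝓘 n hn) hn hf.integrableOn (a := t) (b := t + w n)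
    ht0.le (by linarith) (by linarith)
    (fun s hs hsm => hno s hs ⟨by linarith [hsm.1], hsm.2⟩)
    (fun x hx => hright x ⟨hx.1, by linarith [hx.2]⟩) (by rw [add_sub_cancel_left]) hB.1 hB.2
  rw [hconst] at k2
  have k3 := abs_sub_le (f t) (g.toFun (t - w n)) (Function.leftLim f t)
  rw [abs_sub_comm (f t) (g.toFun (t - w n))] at k3
  linarith

/-- For this `w`, `n w / log n` equals `W (n / log n)^(1 - θ)` and diverges. The finitely many large
jumps of `f` are eventually more than `2 w` apart, so the jumps of `g` assigned to them are
distinct. -/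
theorem eventually_jumps_near {c : ℝ} (hc : 0 < c) {𝓘 : ℕ → Set (ℝ × ℝ)}
    (h𝓘 : ∀ n, 1 ≤ n → IsNormalSystem c n (𝓘 n)) {f : ℝ → ℝ} (hf : IsCadlag f) {K ε W θ : ℝ}
    (hε : 0 < ε) (hW : 0 < W) (hθ0 : 0 < θ) (hθ1 : θ < 1) :
    ∀ᶠ n : ℕ in atTop, ∀ g : StepFunction, IsClose n (𝓘 n) (K * √(Real.log n)) f g →
      (∀ t ∈ jumpSet ε f, ∃ t' ∈ g.jumps, |t - t'| ≤ W * (Real.log n / n) ^ θ) ∧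
      (jumpSet ε f).encard ≤ (g.jumps.card : ℕ∞) := by
  have hu0 : ∀ᶠ n : ℕ in atTop, 0 < Real.log n / n := by
    filter_upwards [eventually_ge_atTop 2] with n hn
    have : (1 : ℝ) < n := by exact_mod_cast hn
    exact div_pos (Real.log_pos this) (by linarith)
  have hw0 : ∀ᶠ n : ℕ in atTop, 0 < W * (Real.log n / n) ^ θ := by
    filter_upwards [hu0] with n hn
    exact mul_pos hW (Real.rpow_pos_of_pos hn _)
  have hw : Tendsto (fun n : ℕ => W * (Real.log n / n) ^ θ) atTop (𝓝 0) := by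
    have := (tendsto_log_div_natCast.rpow_const (p := θ) (Or.inr hθ0.le)).const_mul W
    rwa [Real.zero_rpow hθ0.ne', mul_zero] at this
  have hwlog : Tendsto (fun n : ℕ => Real.log n / (n * (W * (Real.log n / n) ^ θ) / c)) atTop
      (𝓝 0) := by
    have := (tendsto_log_div_natCast.rpow_const (p := 1 - θ)
      (Or.inr (sub_pos.2 hθ1).le)).const_mul (c / W)
    rw [Real.zero_rpow (sub_pos.2 hθ1).ne', mul_zero] at this
    refine this.congr' ?_
    filter_upwards [hu0, eventually_ge_atTop 1] with n hn hn1
    have hn0 : (0 : ℝ) < n := by exact_mod_cast hn1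
    have hp := Real.rpow_pos_of_pos hn θ
    rw [Real.rpow_sub hn, Real.rpow_one]
    field_simp
  have hfin := hf.finite_jumpSet hε
  have hnear := (eventually_all_finite hfin).2 fun t ht =>
    eventually_exists_jump_near (K := K) hc h𝓘 hf hε ht hw0 hw hwlog
  have hsep : ∀ᶠ n : ℕ in atTop, ∀ t ∈ jumpSet ε f, ∀ u ∈ jumpSet ε f, t ≠ u →
      W * (Real.log n / n) ^ θ < |t - u| / 2 := by
    refine (eventually_all_finite hfin).2 fun t _ => (eventually_all_finite hfin).2 fun u _ => ?_
    by_cases htu : t = u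
    · exact Eventually.of_forall fun n h => absurd htu h
    · filter_upwards [hw.eventually_lt_const (half_pos (abs_pos.2 (sub_ne_zero.2 htu)))] with n h _
      exact h
  filter_upwards [hnear, hsep] with n h1 h2 g hg
  have h3 : ∀ t ∈ jumpSet ε f, ∃ t' ∈ g.jumps, |t - t'| ≤ W * (Real.log n / n) ^ θ :=
    fun t ht => h1 t ht g hg
  refine ⟨h3, ?_⟩
  choose! φ hφ hφd using h3
  rw [← Set.encard_coe_eq_coe_finsetCard]
  refine Set.encard_le_encard_of_injOn (f := φ) (fun t ht => hφ t ht) fun t ht u hu htu => ?_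
  by_contra hne
  have k1 := hφd t ht
  have k2 := hφd u hu
  have k3 := h2 t ht u hu hne
  rw [← htu, abs_sub_comm] at k2
  have k4 := abs_sub_le t (φ t) u
  linarith

/-! ### Events of high probability: noise, threshold, number of jumps -/

section HighProbability

variable {Ω : ℕ → Type*} [∀ n, MeasurableSpace (Ω n)] {μ : ∀ n, Measure (Ω n)}

/-- `p n` holds with probability tending to one. -/
def WithHighProb (μ : ∀ n, Measure (Ω n)) (p : ∀ n, Ω n → Prop) : Prop :=
  Tendsto (fun n => μ n {ω | ¬ p n ω}) atTop (𝓝 0)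

/-- Only monotonicity of the outer measure is used, so no event has to be measurable. -/
theorem WithHighProb.of_imp {p q : ∀ n, Ω n → Prop} (hq : WithHighProb μ q)
    (h : ∀ᶠ n in atTop, ∀ᵐ ω ∂(μ n), q n ω → p n ω) : WithHighProb μ p := by
  refine tendsto_of_tendsto_of_tendsto_of_le_of_le' tendsto_const_nhds hq
    (Eventually.of_forall fun _ => zero_le) ?_
  filter_upwards [h] with n hn
  refine measure_mono_ae ?_
  filter_upwards [hn] with ω hω hp
  exact fun hqω => hp (hω hqω)

theorem WithHighProb.and {p q : ∀ n, Ω n → Prop} (hp : WithHighProb μ p) (hq : WithHighProb μ q) :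
    WithHighProb μ fun n ω => p n ω ∧ q n ω := by
  have h := Tendsto.add hp hq
  rw [add_zero] at h
  refine tendsto_of_tendsto_of_tendsto_of_le_of_le tendsto_const_nhds h (fun _ => zero_le)
    fun n => (measure_mono fun ω hω => ?_).trans (measure_union_le _ _)
  by_contra hcon
  simp only [Set.mem_union, Set.mem_ofPred_eq, not_or, not_not] at hcon
  exact hω hcon

variable {σ : ℝ≥0} {ξ : ∀ n, Ω n → Fin n → ℝ} {c : ℝ}
  {𝓘 : ℕ → Set (ℝ × ℝ)}

theorem withHighProb_abs_sum_le [∀ n, IsProbabilityMeasure (μ n)]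
    (hξ : ∀ n, IsNoise (μ n) σ n (fun i ω => ξ n ω i))
    (h𝓘 : ∀ n, 1 ≤ n → IsNormalSystem c n (𝓘 n)) {κ : ℝ} (hκ : 2 * σ < κ) :
    WithHighProb μ fun n ω => ∀ I ∈ 𝓘 n, |∑ l ∈ cells n I, ξ n ω l| ≤
      κ * √(Real.log n) * √((n : ℝ) * (I.2 - I.1)) := by
  have hκ0 : 0 < κ := lt_of_le_of_lt (by positivity) hκ
  -- Positive even if `σ = 0`, and still `2 v < κ`, so the exponent `2 - κ² / (2 v²)` is negative.
  set v : ℝ≥0 := max σ (κ / 4).toNNReal with hv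
  have hvκ : 2 * (v : ℝ) < κ := by
    rw [hv, NNReal.coe_max, Real.coe_toNNReal _ (by positivity)]
    rcases max_choice (σ : ℝ) (κ / 4) with h | h <;> rw [h] <;> linarith
  have hv0 : 0 < (v : ℝ) := by
    rw [hv, NNReal.coe_max, Real.coe_toNNReal _ (by positivity)]
    exact lt_max_of_lt_right (by positivity)
  set p := κ ^ 2 / (2 * (v : ℝ) ^ 2) - 2 with hp
  have hp0 : 0 < p := by
    rw [hp, sub_pos, lt_div_iff₀ (by positivity)]
    nlinarith
  have hlim : Tendsto (fun n : ℕ => ENNReal.ofReal (8 * (n : ℝ) ^ (-p))) atTop (𝓝 0) := by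
    have h1 := ((tendsto_rpow_neg_atTop hp0).comp
      (tendsto_natCast_atTop_atTop (R := ℝ))).const_mul 8
    rw [mul_zero] at h1
    simpa using ENNReal.tendsto_ofReal h1
  refine tendsto_of_tendsto_of_tendsto_of_le_of_le' tendsto_const_nhds hlim
    (Eventually.of_forall fun _ => zero_le) ?_
  filter_upwards [eventually_ge_atTop 1] with n hn
  have h1 := (hξ n).measure_exists_sum_gt_le (h𝓘 n hn) hn (v := v) (le_max_left _ _) hκ0.le
  rw [show (2 - κ ^ 2 / (2 * (v : ℝ) ^ 2)) = -p by rw [hp]; ring] at h1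
  refine le_trans (measure_mono fun ω hω => ?_) h1
  simpa using hω

variable {δ : ℝ} {s : ∀ n, Ω n → (Fin n → ℝ) → StepFunction → ℝ × ℝ → ℝ} {η : ℕ → ℝ}
  {T : ∀ n, Ω n → EReal}

/-- A quantile is a least element: it suffices that the null statistic exceeds `K √(log n)` with
probability at most `β_n`, which the union bound gives since `β_n` decays only polynomially. -/
theorem IsRefinedThreshold.exists_le [∀ n, IsProbabilityMeasure (μ n)]
    (hη : IsRefinedThreshold μ T η)
    (hξ : ∀ n, IsNoise (μ n) σ n (fun i ω => ξ n ω i))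
    (h𝓘 : ∀ n, 1 ≤ n → IsNormalSystem c n (𝓘 n))
    (hs : ∀ n, 2 ≤ n → ∀ᵐ ω ∂(μ n), ∀ z g, ∀ I ∈ 𝓘 n, |s n ω z g I| ≤ δ * √(Real.log n))
    (hT : ∀ n ω, T n ω = multiscaleStat n (𝓘 n) (s n ω (ξ n ω) StepFunction.zero) (ξ n ω)
        StepFunction.zero.toFun) :
    ∃ K, ∀ᶠ n : ℕ in atTop, η n ≤ K * √(Real.log n) := by
  obtain ⟨β, r, R, hr, hR, hβ, -, hβR, hq⟩ := hη
  obtain ⟨C, hC⟩ := hβR.bound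
  set v : ℝ≥0 := σ + 1 with hv
  have hv0 : 0 < (v : ℝ) := by rw [hv]; positivity
  -- The union bound becomes `8 n^(-R - 1)`; the spare factor `1 / n` beats the constant in `n^(-R)
  -- = O(β_n)`.
  set κ := (v : ℝ) * √(2 * (R + 3)) with hκ
  have hκ2 : κ ^ 2 / (2 * (v : ℝ) ^ 2) = R + 3 := by
    rw [hκ, mul_pow, Real.sq_sqrt (by positivity)]
    field_simp
  refine ⟨κ + δ, ?_⟩
  have hlarge : ∀ᶠ n : ℕ in atTop, 8 * C ≤ (n : ℝ) :=
    tendsto_natCast_atTop_atTop.eventually_ge_atTop _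
  filter_upwards [hC, hlarge, eventually_ge_atTop 2] with n hCn hn8 hn2
  have hn1 : 1 ≤ n := by omega
  have hn0 : (0 : ℝ) < n := by exact_mod_cast hn1
  have hβ0 := (hβ n).1
  have hpR : 0 < (n : ℝ) ^ (-R) := Real.rpow_pos_of_pos hn0 _
  rw [Real.norm_of_nonneg hpR.le, Real.norm_of_nonneg hβ0.le] at hCn
  refine (hq n hn1).2 (Set.mem_ofPred.2 ?_)
  have h1 := (hξ n).measure_exists_sum_gt_le (h𝓘 n hn1) hn1 (v := v)
    (le_add_of_nonneg_right zero_le_one) (κ := κ) (by positivity)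
  have h2 : 8 * (n : ℝ) ^ (2 - κ ^ 2 / (2 * (v : ℝ) ^ 2)) ≤ β n := by
    rw [hκ2, show 2 - (R + 3) = -R - 1 by ring, Real.rpow_sub hn0, Real.rpow_one,
      ← mul_div_assoc, div_le_iff₀ hn0]
    nlinarith
  refine le_trans (measure_mono_ae ?_) (h1.trans (ENNReal.ofReal_le_ofReal h2))
  filter_upwards [hs n hn2] with ω hω hTω
  by_contra hcon
  have hcon' : ∀ I ∈ 𝓘 n, |∑ l ∈ cells n I, ξ n ω l| ≤
      κ * √(Real.log n) * √((n : ℝ) * (I.2 - I.1)) := by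
    intro I hI
    by_contra! hlt
    exact hcon ⟨I, hI, hlt⟩
  have hTω' : (((κ + δ) * √(Real.log n) : ℝ) : EReal) < T n ω := hTω
  rw [hT] at hTω'
  refine absurd hTω' (not_lt.2 (nullStat_le_of_abs_sum_le (h𝓘 n hn1) hn1 fun I hI => ?_))
  refine (hcon' I hI).trans (mul_le_mul_of_nonneg_right ?_ (Real.sqrt_nonneg _))
  have := (abs_le.1 (hω (ξ n ω) StepFunction.zero I hI)).1
  linarith

variable {f : ℝ → ℝ} {fhat : ∀ n, Ω n → StepFunction}

theorem exists_withHighProb_isClose [∀ n, IsProbabilityMeasure (μ n)]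
    (hf : IsCadlag f)
    (hη : IsUniversalThreshold σ δ η ∨ IsRefinedThreshold μ T η)
    (hξ : ∀ n, IsNoise (μ n) σ n (fun i ω => ξ n ω i))
    (h𝓘 : ∀ n, 1 ≤ n → IsNormalSystem c n (𝓘 n))
    (hs : ∀ n, 2 ≤ n → ∀ᵐ ω ∂(μ n), ∀ z g, ∀ I ∈ 𝓘 n, |s n ω z g I| ≤ δ * √(Real.log n))
    (hfhat : ∀ n, 1 ≤ n → ∀ᵐ ω ∂(μ n), IsSegmentation n (𝓘 n)
      (s n ω (obs n f (ξ n ω))) (obs n f (ξ n ω)) (η n) (fhat n ω))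
    (hT : ∀ n ω, T n ω = multiscaleStat n (𝓘 n) (s n ω (ξ n ω) StepFunction.zero) (ξ n ω)
        StepFunction.zero.toFun) :
    ∃ K, WithHighProb μ fun n ω => IsClose n (𝓘 n) (K * √(Real.log n)) f (fhat n ω) := by
  obtain ⟨K, hK⟩ : ∃ K, ∀ᶠ n : ℕ in atTop, η n ≤ K * √(Real.log n) := by
    rcases hη with ⟨a, r, -, -, ha⟩ | hη
    · exact ⟨a, Eventually.of_forall fun n => (ha n).le⟩
    · exact hη.exists_le hξ h𝓘 hs hT
  -- Threshold, penalty and noise, in this order.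
  refine ⟨K + δ + (2 * σ + 1),
    (withHighProb_abs_sum_le hξ h𝓘 (κ := 2 * σ + 1) (by linarith)).of_imp ?_⟩
  filter_upwards [hK, eventually_ge_atTop 2] with n hKn hn2
  have hn1 : 1 ≤ n := by omega
  filter_upwards [hs n hn2, hfhat n hn1] with ω hsω hω hX I hI v hv
  refine (abs_localMean_sub_le_of_stat_le (h𝓘 n hn1) hn1 hf.integrableOn hω.1 hI hv
    (hX I hI)).trans (div_le_div_of_nonneg_right ?_ (Real.sqrt_nonneg _))
  have := (abs_le.1 (hsω (obs n f (ξ n ω)) (fhat n ω) I hI)).2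
  linarith

/-- The noise stays below the threshold by a polynomially small margin, whatever the candidate. -/
theorem exists_withHighProb_margin [∀ n, IsProbabilityMeasure (μ n)]
    {γ : ℝ} (hγ : 0 < γ) {y : ∀ n, Ω n → Fin n → ℝ}
    (hη : IsUniversalThreshold σ δ η ∨
      ((∀ n, 1 ≤ n → ∀ᵐ ω ∂(μ n),
          NullDominated (𝓘 n) (s n ω (ξ n ω) StepFunction.zero) (s n ω (y n ω))) ∧
        ∃ ρ : ℝ, ρ < γ ∧
          Tendsto (fun n : ℕ => μ n {ω | ((η n - (n : ℝ) ^ (-ρ) : ℝ) : EReal) < T n ω})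
            atTop (𝓝 0)))
    (hξ : ∀ n, IsNoise (μ n) σ n (fun i ω => ξ n ω i))
    (h𝓘 : ∀ n, 1 ≤ n → IsNormalSystem c n (𝓘 n))
    (hs : ∀ n, 2 ≤ n → ∀ᵐ ω ∂(μ n), ∀ z g, ∀ I ∈ 𝓘 n, |s n ω z g I| ≤ δ * √(Real.log n))
    (hT : ∀ n ω, T n ω = multiscaleStat n (𝓘 n) (s n ω (ξ n ω) StepFunction.zero) (ξ n ω)
        StepFunction.zero.toFun) :
    ∃ ρ : ℝ, 0 < ρ ∧ ρ < γ ∧ WithHighProb μ fun n ω => ∀ g, ∀ I ∈ 𝓘 n,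
      |∑ l ∈ cells n I, ξ n ω l| ≤
        (η n + s n ω (y n ω) g I - (n : ℝ) ^ (-ρ)) * √((n : ℝ) * (I.2 - I.1)) := by
  rcases hη with ⟨a, r, hr, har, hηa⟩ | ⟨hnull, ρ₀, hρ₀, hlim⟩
  · have h2σ : δ + 2 * σ < a := by
      have h1 : (2 : ℝ) ≤ √(2 * r + 4) := Real.le_sqrt_of_sq_le (by linarith)
      have h2 : (σ : ℝ) * 2 ≤ σ * √(2 * r + 4) := mul_le_mul_of_nonneg_left h1 σ.2
      linarith
    -- Midway between `2 σ`, above which the noise bound holds, and `a - δ`, the least the penalized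
    -- threshold provides.
    set κ := (a - δ + 2 * σ) / 2 with hκ
    refine ⟨γ / 2, half_pos hγ, half_lt_self hγ,
      (withHighProb_abs_sum_le hξ h𝓘 (κ := κ) (by rw [hκ]; linarith)).of_imp ?_⟩
    have hslack : 0 < a - δ - κ := by rw [hκ]; linarith
    have hlog : Tendsto (fun n : ℕ => Real.log n) atTop atTop :=
      Real.tendsto_log_atTop.comp tendsto_natCast_atTop_atTop
    have hpow : Tendsto (fun n : ℕ => (n : ℝ) ^ (-(γ / 2))) atTop (𝓝 0) :=
      (tendsto_rpow_neg_atTop (half_pos hγ)).comp tendsto_natCast_atTop_atTop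
    filter_upwards [eventually_ge_atTop 2, hlog.eventually_ge_atTop 1,
      hpow.eventually_le_const hslack] with n hn2 hlogn hpn
    filter_upwards [hs n hn2] with ω hsω hX g I hI
    refine (hX I hI).trans (mul_le_mul_of_nonneg_right ?_ (Real.sqrt_nonneg _))
    have h1 := (abs_le.1 (hsω (y n ω) g I hI)).1
    have h2 : 1 ≤ √(Real.log n) := Real.one_le_sqrt.2 hlogn
    rw [hηa n]
    nlinarith
  -- The given `ρ₀` may be nonpositive; a larger exponent only asks for a smaller margin.
  · set ρ := max ρ₀ (γ / 2) with hρ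
    refine ⟨ρ, lt_max_of_lt_right (half_pos hγ), max_lt hρ₀ (half_lt_self hγ), ?_⟩
    have hq : WithHighProb μ fun n ω => ¬ ((η n - (n : ℝ) ^ (-ρ₀) : ℝ) : EReal) < T n ω := by
      simpa [WithHighProb] using hlim
    refine hq.of_imp ?_
    filter_upwards [eventually_ge_atTop 1] with n hn
    filter_upwards [hnull n hn] with ω hω hTω g I hI
    have hn1 : (1 : ℝ) ≤ n := by exact_mod_cast hn
    have hT' := not_lt.1 hTω
    rw [hT] at hT'
    refine (abs_sum_le_of_nullStat_le (h𝓘 n hn) hn hT' hI).trans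
      (mul_le_mul_of_nonneg_right ?_ (Real.sqrt_nonneg _))
    have h1 := hω g I hI
    have h2 : (n : ℝ) ^ (-ρ) ≤ (n : ℝ) ^ (-ρ₀) :=
      Real.rpow_le_rpow_of_exponent_le hn1 (neg_le_neg (le_max_left _ _))
    linarith

/-- The exponent balances the jumps of the approximant, about `n^θ`, against the further cuts, of
order `n^(-2γθ) / t` with `t` of order `n^(-1-2ρ)`. It is below one exactly because `ρ < γ`. -/
theorem withHighProb_card_jumps_le {γ L : ℝ} (hL : 0 < L) (hfA : f ∈ ApproxClass 2 γ L)
    (h𝓘 : ∀ n, 1 ≤ n → IsNormalSystem c n (𝓘 n))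
    (hfhat : ∀ n, 1 ≤ n → ∀ᵐ ω ∂(μ n), IsSegmentation n (𝓘 n)
      (s n ω (obs n f (ξ n ω))) (obs n f (ξ n ω)) (η n) (fhat n ω)) {ρ : ℝ} (hρ : 0 < ρ)
    (hργ : ρ < γ)
    (hmargin : WithHighProb μ fun n ω => ∀ g, ∀ I ∈ 𝓘 n,
      |∑ l ∈ cells n I, ξ n ω l| ≤
        (η n + s n ω (obs n f (ξ n ω)) g I - (n : ℝ) ^ (-ρ)) * √((n : ℝ) * (I.2 - I.1))) :
    WithHighProb μ fun n ω => ((fhat n ω).jumps.card : ℝ) ≤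
      (2 + 16 * L ^ 2) * (n : ℝ) ^ ((1 + 2 * ρ) / (1 + 2 * γ)) := by
  have hγ : 0 < γ := hρ.trans hργ
  have hf : IsCadlag f := hfA.1
  refine hmargin.of_imp ?_
  filter_upwards [eventually_ge_atTop 1] with n hn
  have hn1 : (1 : ℝ) ≤ n := by exact_mod_cast hn
  have hn0 : (0 : ℝ) < n := by linarith
  set θ := (1 + 2 * ρ) / (1 + 2 * γ) with hθ
  have hθ0 : 0 < θ := by positivity
  have hθγ : θ * (1 + 2 * γ) = 1 + 2 * ρ := by rw [hθ]; field_simp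
  have hnθ : 1 ≤ (n : ℝ) ^ θ := Real.one_le_rpow hn1 hθ0.le
  set k := ⌈(n : ℝ) ^ θ⌉₊ with hk
  have hk1 : 1 ≤ k := Nat.one_le_ceil_iff.2 (by linarith)
  obtain ⟨g₀, hg₀, hint⟩ := ApproxClass.exists_stepFunction hL hfA hk1
  have hkθ : (k : ℝ) ^ (-(2 * γ)) ≤ (n : ℝ) ^ (-(2 * γ * θ)) := by
    rw [show -(2 * γ * θ) = θ * (-(2 * γ)) by ring, Real.rpow_mul hn0.le]
    exact Real.rpow_le_rpow_of_nonpos (by linarith) (Nat.le_ceil _) (by linarith)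
  have hE : ∫ x in Set.Ico (0 : ℝ) 1, (f x - g₀.toFun x) ^ 2 ≤
      (2 * L) ^ 2 * (n : ℝ) ^ (-(2 * γ * θ)) :=
    hint.trans (mul_le_mul_of_nonneg_left hkθ (by positivity))
  -- The mass `t` allowed between cuts is chosen so that the bias `√n * (2 √t)` equals the margin
  -- `n^(-ρ)`.
  have ht : 0 < ((n : ℝ) ^ (-ρ)) ^ 2 / (4 * n) := by positivity
  obtain ⟨g, hgcard, hg⟩ := hf.exists_candidate g₀ ht hE
  have hquot : (2 * L) ^ 2 * (n : ℝ) ^ (-(2 * γ * θ)) / (((n : ℝ) ^ (-ρ)) ^ 2 / (4 * n)) =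
      16 * L ^ 2 * (n : ℝ) ^ θ := by
    have e1 : (n : ℝ) ^ θ * ((n : ℝ) ^ (-ρ)) ^ 2 = (n : ℝ) ^ (-(2 * γ * θ)) * n := by
      rw [← Real.rpow_natCast ((n : ℝ) ^ (-ρ)), ← Real.rpow_mul hn0.le, ← Real.rpow_add hn0]
      nth_rewrite 3 [← Real.rpow_one (n : ℝ)]
      rw [← Real.rpow_add hn0]
      congr 1
      push_cast
      linarith
    rw [div_div_eq_mul_div, div_eq_iff (by positivity)]
    linear_combination (-16 * L ^ 2) * e1
  rw [hquot] at hgcard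
  have hkle : (k : ℝ) ≤ 2 * (n : ℝ) ^ θ := by
    have := (Nat.ceil_lt_add_one (a := (n : ℝ) ^ θ) (by linarith)).le
    linarith
  have hg₀' : (g₀.jumps.card : ℝ) ≤ k := by exact_mod_cast hg₀
  have hsqrt : √(n : ℝ) * (2 * √(((n : ℝ) ^ (-ρ)) ^ 2 / (4 * n))) ≤ (n : ℝ) ^ (-ρ) := by
    rw [show √(n : ℝ) * (2 * √(((n : ℝ) ^ (-ρ)) ^ 2 / (4 * n))) =
      2 * (√(n : ℝ) * √(((n : ℝ) ^ (-ρ)) ^ 2 / (4 * n))) by ring, ← Real.sqrt_mul hn0.le,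
      show (n : ℝ) * (((n : ℝ) ^ (-ρ)) ^ 2 / (4 * n)) = ((n : ℝ) ^ (-ρ) / 2) ^ 2 by
        field_simp; norm_num,
      Real.sqrt_sq (by positivity)]
    linarith
  filter_upwards [hfhat n hn] with ω hω hX
  have hfeas := multiscaleStat_le_of_close (h𝓘 n hn) hn hf.integrableOn (hX g) hg hsqrt
  have hle : ((fhat n ω).jumps.card : ℝ) ≤ g.jumps.card := by exact_mod_cast hω.2 g hfeas
  linarith

end HighProbability

/-! ### Conclusion -/

theorem eventually_modes_and_troughs {c : ℝ} (hc : 0 < c) {𝓘 : ℕ → Set (ℝ × ℝ)}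
    (h𝓘 : ∀ n, 1 ≤ n → IsNormalSystem c n (𝓘 n)) {f : ℝ → ℝ} (hf : IsCadlag f) {K D θ : ℝ}
    (hD : 0 < D) (hθ : θ < 1) {M M' : ℕ} (hM : (M : ℕ∞) ≤ numModes f)
    (hM' : (M' : ℕ∞) ≤ numTroughs f) :
    ∀ᶠ n : ℕ in atTop, ∀ g : StepFunction, IsClose n (𝓘 n) (K * √(Real.log n)) f g →
      (g.jumps.card : ℝ) ≤ D * (n : ℝ) ^ θ →
        (M : ℕ∞) ≤ numModes g.toFun ∧ (M' : ℕ∞) ≤ numTroughs g.toFun := by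
  have hne : ∃ x : ℝ, x ∈ Set.Ico (0 : ℝ) 1 := ⟨0, by norm_num⟩
  obtain ⟨m, hMm, hm⟩ := exists_hasModes_of_le_numModes hM hne
  obtain ⟨m', hMm', hm'⟩ := exists_hasModes_of_le_numModes hM' hne
  have h1 := hm.eventually (P := fun n φ => ∃ g : StepFunction, φ = g.toFun ∧
      IsClose n (𝓘 n) (K * √(Real.log n)) f g ∧ (g.jumps.card : ℝ) ≤ D * (n : ℝ) ^ θ) (by
    intro e he x hx
    filter_upwards [eventually_exists_abs_sub_le hc h𝓘 hf (K := K) hD hθ hx he] with n hn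
    rintro _ ⟨g, rfl, hg, hgc⟩
    exact hn g hg hgc)
  have h2 := hm'.eventually (P := fun n φ => ∃ g : StepFunction, (φ = fun x => -g.toFun x) ∧
      IsClose n (𝓘 n) (K * √(Real.log n)) f g ∧ (g.jumps.card : ℝ) ≤ D * (n : ℝ) ^ θ) (by
    intro e he x hx
    filter_upwards [eventually_exists_abs_sub_le hc h𝓘 hf (K := K) hD hθ hx he] with n hn
    rintro _ ⟨g, rfl, hg, hgc⟩
    obtain ⟨p, hp, hp1, hpe⟩ := hn g hg hgc
    refine ⟨p, hp, hp1, ?_⟩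
    rwa [neg_sub_neg, abs_sub_comm])
  filter_upwards [h1, h2] with n hn1 hn2 g hg hgc
  exact ⟨(hn1 _ ⟨g, rfl, hg, hgc⟩).le_numModes hMm, (hn2 _ ⟨g, rfl, hg, hgc⟩).le_numModes hMm'⟩

theorem localMean_eq_of_const {g : ℝ → ℝ} {I : ℝ × ℝ} {v : ℝ} (hI : I.1 < I.2)
    (h : ∀ x ∈ Set.Ico I.1 I.2, g x = v) : localMean g I = v := by
  have hpos : 0 < I.2 - I.1 := sub_pos.2 hI
  rw [localMean, setIntegral_congr_fun measurableSet_Ico h, setIntegral_const,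
    Real.volume_real_Ico_of_le hI.le, smul_eq_mul, mul_div_cancel_left₀ _ hpos.ne']

end Multiscale

theorem theorem3 (c L : ℝ) (hc : 1 < c) (hL : 0 < L) (η : ℕ → ℝ) :
    -- the constant depends only on `c`, `L` and the thresholds
    ∃ C : ℝ, 0 < C ∧
    ∀ (Ω : ℕ → Type*) [∀ n, MeasurableSpace (Ω n)] (μ : ∀ n, Measure (Ω n))
      [∀ n, IsProbabilityMeasure (μ n)]
      (σ : ℝ≥0) (δ : ℝ) (_ : 0 < δ)
      -- the truth, the noise and the data
      (f : ℝ → ℝ) (_ : IsCadlag f)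
      (ξ : ∀ n, Ω n → Fin n → ℝ) (_ : ∀ n, IsNoise (μ n) σ n (fun i ω => ξ n ω i))
      (y : ∀ n, Ω n → Fin n → ℝ) (_ : ∀ n ω, y n ω = obs n f (ξ n ω))
      -- the interval systems
      (𝓘 : ℕ → Set (ℝ × ℝ)) (_ : ∀ n, 1 ≤ n → IsNormalSystem c n (𝓘 n))
      -- the scale penalties: random, and dependent on a data vector and on a candidate
      (s : ∀ n, Ω n → (Fin n → ℝ) → StepFunction → ℝ × ℝ → ℝ)
      (_ : ∀ n, 2 ≤ n → ∀ᵐ ω ∂(μ n), ∀ z g, ∀ I ∈ 𝓘 n, |s n ω z g I| ≤ δ * √(Real.log n))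
      -- the estimator
      (fhat : ∀ n, Ω n → StepFunction)
      (_ : ∀ n, 1 ≤ n → ∀ᵐ ω ∂(μ n),
        IsSegmentation n (𝓘 n) (s n ω (y n ω)) (y n ω) (η n) (fhat n ω))
      -- the null statistic
      (T : ∀ n, Ω n → EReal)
      (_ : ∀ n ω, T n ω = multiscaleStat n (𝓘 n) (s n ω (ξ n ω) StepFunction.zero) (ξ n ω)
        StepFunction.zero.toFun),
      -- (i) modes and troughs
      (∀ γ : ℝ, 0 < γ → f ∈ ApproxClass 2 γ L →
        (IsUniversalThreshold σ δ η ∨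
          (IsRefinedThreshold μ T η ∧
            (∀ n, 1 ≤ n → ∀ᵐ ω ∂(μ n),
              NullDominated (𝓘 n) (s n ω (ξ n ω) StepFunction.zero) (s n ω (y n ω))) ∧
            ∃ ρ : ℝ, ρ < γ ∧
              Tendsto (fun n : ℕ => μ n {ω | ((η n - (n : ℝ) ^ (-ρ) : ℝ) : EReal) < T n ω})
                atTop (𝓝 0))) →
        ∀ M M' : ℕ, (M : ℕ∞) ≤ numModes f → (M' : ℕ∞) ≤ numTroughs f →
          Tendsto (fun n => μ n {ω | ¬ ((M : ℕ∞) ≤ numModes (fhat n ω).toFun ∧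
            (M' : ℕ∞) ≤ numTroughs (fhat n ω).toFun)}) atTop (𝓝 0)) ∧
      -- (i) jumps
      (∀ γ : ℝ, 0 < γ → f ∈ ApproxClass 2 γ L →
        (IsUniversalThreshold σ δ η ∨ IsRefinedThreshold μ T η) →
        ∀ ε : ℝ, 0 < ε →
          Tendsto (fun n : ℕ => μ n {ω | ¬ (
            (∀ t ∈ jumpSet ε f, ∃ t' ∈ (fhat n ω).jumps,
              |t - t'| ≤ C / (minJump ε f) ^ 2 *
                (Real.log n / n) ^ (2 * γ / (2 * γ + 1))) ∧
            (jumpSet ε f).encard ≤ ((fhat n ω).jumps.card : ℕ∞))}) atTop (𝓝 0)) ∧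
      -- (ii) simultaneous inference at finite sample size
      (∀ n, 1 ≤ n → ∀ β : ℝ, β ∈ Set.Ioo (0 : ℝ) 1 → IsQuantile (μ n) (T n) β (η n) →
        (∀ᵐ ω ∂(μ n),
          NullDominated (𝓘 n) (s n ω (ξ n ω) StepFunction.zero) (s n ω (y n ω))) →
        ∀ r : Ω n → ℝ × ℝ → ℝ,
        (∀ ω I, r ω I =
          2 * (η n + s n ω (y n ω) (fhat n ω) I) / √((n : ℝ) * (I.2 - I.1))) →
        μ n {ω | ¬ ∀ I₁ ∈ 𝓘 n, ∀ I₂ ∈ 𝓘 n,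
          (∃ a, ∀ x ∈ Set.Ico I₁.1 I₁.2, (fhat n ω).toFun x = a) →
          (∃ a, ∀ x ∈ Set.Ico I₂.1 I₂.2, (fhat n ω).toFun x = a) →
          localMean (fhat n ω).toFun I₁ > localMean (fhat n ω).toFun I₂ + r ω I₁ + r ω I₂ →
          localMean f I₁ > localMean f I₂} ≤ ENNReal.ofReal β) := by
  have hc0 : 0 < c := one_pos.trans hc
  -- Any positive constant would do, since `2γ / (2γ + 1) < 1` and the limit is taken for fixed `f`.
  refine ⟨1, one_pos, ?_⟩
  intro Ω _ μ _ σ δ _ f hf ξ hξ y hy 𝓘 h𝓘 s hs fhat hfhat T hT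
  have hfhat' : ∀ n, 1 ≤ n → ∀ᵐ ω ∂(μ n), IsSegmentation n (𝓘 n)
      (s n ω (obs n f (ξ n ω))) (obs n f (ξ n ω)) (η n) (fhat n ω) := by
    simpa only [hy] using hfhat
  refine ⟨?_, ?_, ?_⟩
  · intro γ hγ hfA hη M M' hM hM'
    obtain ⟨K, hK⟩ := exists_withHighProb_isClose hf (hη.imp_right fun h => h.1) hξ h𝓘 hs hfhat' hT
    obtain ⟨ρ, hρ, hργ, hmargin⟩ := exists_withHighProb_margin hγ (y := y)
      (hη.imp_right fun h => h.2) hξ h𝓘 hs hT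
    simp only [hy] at hmargin
    have hcard := withHighProb_card_jumps_le hL hfA h𝓘 hfhat' hρ hργ hmargin
    refine (hK.and hcard).of_imp ?_
    have hθ : (1 + 2 * ρ) / (1 + 2 * γ) < 1 := by
      rw [div_lt_one (by positivity)]
      linarith
    filter_upwards [eventually_modes_and_troughs hc0 h𝓘 hf (K := K) (D := 2 + 16 * L ^ 2)
      (by positivity) hθ hM hM'] with n hn
    exact Eventually.of_forall fun ω hω => hn _ hω.1 hω.2
  · intro γ hγ hfA hη ε hε
    obtain ⟨K, hK⟩ := exists_withHighProb_isClose hf hη hξ h𝓘 hs hfhat' hT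
    refine hK.of_imp ?_
    -- Without large jumps `minJump` is the infimum of the empty set, namely `0`, but the claims are
    -- then trivial.
    rcases (jumpSet ε f).eq_empty_or_nonempty with hJ | hJ
    · refine Eventually.of_forall fun n => Eventually.of_forall fun ω _ => ?_
      simp [hJ]
    · have hΔ : 0 < minJump ε f := hε.trans_le (le_minJump hJ)
      have hθ : 2 * γ / (2 * γ + 1) < 1 := by
        rw [div_lt_one (by positivity)]
        linarith
      filter_upwards [eventually_jumps_near hc0 h𝓘 hf (K := K) (W := 1 / minJump ε f ^ 2) hε
        (by positivity) (by positivity) hθ] with n hn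
      exact Eventually.of_forall fun ω hω => hn _ hω
  · intro n hn β _ hq hnull r hr
    -- Almost surely, a false implication forces the null statistic above its quantile.
    refine le_trans (measure_mono_ae ?_) hq.1
    filter_upwards [hfhat' n hn, hnull] with ω hω hnullω hbad
    by_contra hTω
    refine hbad ?_
    have hTω' : T n ω ≤ (η n : EReal) := not_lt.1 hTω
    rw [hT] at hTω'
    have key : ∀ I ∈ 𝓘 n, (∃ a, ∀ x ∈ Set.Ico I.1 I.2, (fhat n ω).toFun x = a) →
        |localMean f I - localMean (fhat n ω).toFun I| ≤ r ω I := by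
      rintro I hI ⟨a, ha⟩
      obtain ⟨-, h2, -⟩ := (h𝓘 n hn).mem hn hI
      rw [localMean_eq_of_const h2 ha, hr]
      have hX := abs_sum_le_of_nullStat_le (h𝓘 n hn) hn hTω' hI
      refine (abs_localMean_sub_le_of_stat_le (h𝓘 n hn) hn hf.integrableOn hω.1 hI ha hX).trans
        (div_le_div_of_nonneg_right ?_ (Real.sqrt_nonneg _))
      have := hnullω (fhat n ω) I hI
      rw [hy] at this ⊢
      linarith
    intro I₁ hI₁ I₂ hI₂ hc₁ hc₂ hlt
    have k1 := abs_le.1 (key I₁ hI₁ hc₁)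
    have k2 := abs_le.1 (key I₂ hI₂ hc₂)
    linarith [k1.1, k2.2]
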